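/- Let $H=(V,E)$ be a finite multi-hypergraph ($E$ is a finite multiset of subsets of the finite set $V$; empty edges are allowed) that is connected (i.e. $V\ne\emptyset$ and any two vertices are joined by a chain of vertices in which consecutive ones lie in a common edge) and has more than one edge. Let $\mu=\mathrm{MVC}_1(H)$ be the minimum of $\sum_{v\in V}f(v)+\sum_{e\in E}f(e)$ over all $f:V\cup E\to[0,\infty)$ with $\sum_{v\in e}f(v)+f(e)\ge 1$ for every $e\in E$. **The game $\mathtt{Counting}(H,n,T,\varepsilon)$.** Let $N=T+(n-T)|E|$. For $e\in E$ fix $n$-element sets $L_e\subseteq[N]$ that contain $[T]$, satisfy $L_a\cap L_b=[T]$ for $a\ne b$ and have union $[N]$, and bijections $\rho_e:[n]\to L_e$ that are the identity on $[T]$. An instance, drawn from the hard distribution, consists of: independent uniform strings $x_e\in\{0,1\}^n$ ($e\in E$); strings $\tilde x_e$ obtained from $x_e$ by flipping each bit independently with probability $\tfrac12-\tfrac12\varepsilon^{1/|E|}$; independent uniform permutations $\pi_e$ of $L_e$ ($e\in E$) and $\pi_v$ of $[N]$ ($v\in V$); and $\tau$ uniform in $\{0^T,1^T\}$; the strings $x_e$,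 the flips, the permutations and $\tau$ are independent. For each $e\in E$ there is a player, who sees the string in $\{0,1\}^{L_e}$ whose bit at $i\in L_e$ is the bit of $\tilde x_e$ with index $\rho_e^{-1}(\pi_e^{-1}(i))$, and the names $\pi_v(\pi_e^{-1}(i))$ for $v\in e$, $i\in L_e$. The players simultaneously send one message each, a finite bit string, to a referee, who knows all permutations and $\tau\oplus\bigoplus_{e}x_e^{1:T}$ (where $x^{1:T}$ denotes the first $T$ bits of $x$) and has to guess $\tau$. **Theorem.** There is a constant $\gamma>0$ depending only on $H$ such that the following holds for all positive integers $n,T$ with $T<n/10$, all $c\in\{1,\dots,n\}$, all $\varepsilon\in(0,1)$ and all $\delta>0$ with $$c\le\gamma\,\frac{n}{(\delta^{-2}\varepsilon^{2}T)^{1/\mu}} .$$ 1. Suppose that the players are deterministic and that no player sends more than $c$ bits on any input. Let $p$ be the referee's posterior distribution on $\bigoplus_{e}x_e^{1:T}\in\{0,1\}^T$ given all permutations and all messages, but before considering $\tau\oplus\bigoplus_e x_e^{1:T}$, and let $\upsilon$ be the uniform distribution on $\{0,1\}^T$. Then, in expectation over the instance, $\mathbb E\,\|p-\upsilon\|_{TV}\le\delta$.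 2. If no player sends more than $c$ bits on any input, then the referee guesses $\tau$ correctly with probability at most $\tfrac12+\delta$, whatever the referee's decision rule, even if the players and the referee are randomized with shared randomness independent of the instance. -/

import Mathlib

open Finset

/-- A finite multi-hypergraph with vertex type `V` and edges indexed by `E`. Distinct indices may
carry the same vertex set, and a vertex set may be empty. -/
structure MultiHypergraph (V E : Type*) where
  verts : E → Finset V

namespace MultiHypergraph

variable {V E : Type*}

/-- Connectedness: there is a vertex, and any two vertices are joined by a finite chain of vertices
in which consecutive ones lie in a common edge. -/
def Connected (H : MultiHypergraph V E) : Prop :=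
  Nonempty V ∧
    ∀ u v : V, Relation.ReflTransGen (fun a b => ∃ e, a ∈ H.verts e ∧ b ∈ H.verts e) u v

/-- The `lam`-modified fractional vertex cover number: the least value of
`∑ v, f v + lam * ∑ e, g e` over nonnegative masses `f` on vertices and `g` on edges such that
every edge `e` satisfies `∑ v ∈ e, f v + g e ≥ 1`. -/
noncomputable def MVC [Fintype V] [Fintype E] (H : MultiHypergraph V E) (lam : ℝ) : ℝ :=
  sInf {r : ℝ | ∃ (f : V → ℝ) (g : E → ℝ), (∀ v, 0 ≤ f v) ∧ (∀ e, 0 ≤ g e) ∧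
    (∀ e, 1 ≤ ∑ v ∈ H.verts e, f v + g e) ∧ r = ∑ v, f v + lam * ∑ e, g e}

end MultiHypergraph

namespace CountingGame

/-- The number `N = T + (n - T)|E|` of labels. -/
abbrev numLabels (E : Type*) [Fintype E] (n T : ℕ) : ℕ := T + (n - T) * Fintype.card E

/-- The sets `L e ⊆ [N]` and bijections `ρ e : [n] → L e`: the sets `L e` have `n` elements,
contain `[T]`, meet pairwise exactly in `[T]` and cover `[N]`, and `ρ e` is the identity on `[T]`.
Here `[m]` is `{0, …, m - 1}`. -/
structure Layout (E : Type*) [Fintype E] (n T : ℕ) where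
  T_le : T ≤ n
  L : E → Finset (Fin (numLabels E n T))
  contains : ∀ e m, m.val < T → m ∈ L e
  inter : ∀ a b, a ≠ b → ∀ m, m ∈ L a → m ∈ L b → m.val < T
  cover : ∀ m, ∃ e, m ∈ L e
  ρ : ∀ e, Fin n ≃ {m // m ∈ L e}
  ρ_fix : ∀ e (i : Fin n), i.val < T → (ρ e i).val.val = i.val

variable {V E : Type*} [Fintype V] [DecidableEq V] [Fintype E] [DecidableEq E] {n T : ℕ}

/-- An instance of the game. Bits are elements of `ZMod 2`, so that XOR is addition; `x e` and
`xt e` are the clean and the noisy string of the edge `e`; the string `τ ∈ {0^T, 1^T}` is recorded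
by its repeated bit `tau`. -/
structure Instance (V : Type*) (D : Layout E n T) where
  x : E → Fin n → ZMod 2
  xt : E → Fin n → ZMod 2
  permE : ∀ e, Equiv.Perm {m // m ∈ D.L e}
  permV : V → Equiv.Perm (Fin (numLabels E n T))
  tau : ZMod 2

/-- An instance is a tuple of its components. -/
def instanceEquiv (V : Type*) (D : Layout E n T) :
    ((E → Fin n → ZMod 2) × (E → Fin n → ZMod 2) × (∀ e, Equiv.Perm {m // m ∈ D.L e}) ×
      (V → Equiv.Perm (Fin (numLabels E n T))) × ZMod 2) ≃ Instance V D where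
  toFun t := ⟨t.1, t.2.1, t.2.2.1, t.2.2.2.1, t.2.2.2.2⟩
  invFun ω := (ω.x, ω.xt, ω.permE, ω.permV, ω.tau)
  left_inv _ := rfl
  right_inv _ := rfl

instance (D : Layout E n T) : Fintype (Instance V D) := Fintype.ofEquiv _ (instanceEquiv V D)

/-- What the player of edge `e` sees: a bit for each position in `L e`, and, for each vertex `v`
of `e` and each position in `L e`, a vertex name in `[N]`. -/
abbrev PlayerView (H : MultiHypergraph V E) (D : Layout E n T) (e : E) : Type _ :=
  ({m // m ∈ D.L e} → ZMod 2) ×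
    ({v // v ∈ H.verts e} → {m // m ∈ D.L e} → Fin (numLabels E n T))

/-- The view of player `e`: the string `xt e`, transported to `L e` by `ρ e` and then permuted by
`π_e` (so position `i` shows the bit of `xt e` with index `ρ_e⁻¹(π_e⁻¹(i))`), and the names
`π_v(π_e⁻¹(i))` for `v ∈ e` and `i ∈ L e`. -/
def playerView (H : MultiHypergraph V E) {D : Layout E n T} (ω : Instance V D) (e : E) :
    PlayerView H D e :=
  (fun i => ω.xt e ((D.ρ e).symm ((ω.permE e).symm i)),
   fun v i => ω.permV v.val ((ω.permE e).symm i).val)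

/-- A deterministic simultaneous protocol: for every player, a function from views to messages,
which are finite bit strings. -/
abbrev Protocol (H : MultiHypergraph V E) (D : Layout E n T) : Type _ :=
  ∀ e, PlayerView H D e → List Bool

/-- No player sends more than `c` bits on any input to the game. -/
def Protocol.AtMostBits {H : MultiHypergraph V E} {D : Layout E n T} (P : Protocol H D)
    (c : ℕ) : Prop :=
  ∀ (ω : Instance V D) (e : E), (P e (playerView H ω e)).length ≤ c

/-- The messages sent on the instance `ω`. -/
def messages {H : MultiHypergraph V E} {D : Layout E n T} (P : Protocol H D) (ω : Instance V D) :
    E → List Bool :=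
  fun e => P e (playerView H ω e)

/-- The XOR over all edges of the first `T` bits of the clean strings. -/
def xorPrefix {D : Layout E n T} (ω : Instance V D) : Fin T → ZMod 2 :=
  fun j => ∑ e, ω.x e (Fin.castLE D.T_le j)

/-- The probability of the instance `ω` in the hard distribution: the clean strings, all
permutations and `τ` are uniform and independent, and each bit of each `xt e` is obtained from that
of `x e` by an independent flip of probability `1/2 - ε^(1/|E|)/2`. -/
noncomputable def hardProb {D : Layout E n T} (ε : ℝ) (ω : Instance V D) : ℝ :=
  (Fintype.card (E → Fin n → ZMod 2) : ℝ)⁻¹ *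
  (∏ e : E, ∏ i : Fin n,
    if ω.xt e i = ω.x e i then 1 - (1 / 2 - ε ^ (1 / (Fintype.card E : ℝ)) / 2)
    else 1 / 2 - ε ^ (1 / (Fintype.card E : ℝ)) / 2) *
  (Fintype.card (∀ e, Equiv.Perm {m // m ∈ D.L e}) : ℝ)⁻¹ *
  (Fintype.card (V → Equiv.Perm (Fin (numLabels E n T))) : ℝ)⁻¹ *
  (1 / 2)

/-- Expectation under the hard distribution. -/
noncomputable def expect {D : Layout E n T} (ε : ℝ) (X : Instance V D → ℝ) : ℝ :=
  ∑ ω, hardProb ε ω * X ω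

open Classical in
/-- Probability of an event under the hard distribution. -/
noncomputable def prob {D : Layout E n T} (ε : ℝ) (A : Instance V D → Prop) : ℝ :=
  expect ε (fun ω => if A ω then 1 else 0)

/-- `ω'` agrees with `ω` in everything the referee has before looking at `τ ⊕ ⨁ₑ xₑ^{1:T}`, namely
all permutations and all messages. -/
def SameView {H : MultiHypergraph V E} {D : Layout E n T} (P : Protocol H D)
    (ω ω' : Instance V D) : Prop :=
  ω'.permE = ω.permE ∧ ω'.permV = ω.permV ∧ messages P ω' = messages P ω

/-- The referee's posterior distribution of `⨁ₑ xₑ^{1:T}` on the instance `ω`: its conditional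
distribution given all permutations and all messages. -/
noncomputable def posterior {H : MultiHypergraph V E} {D : Layout E n T} (ε : ℝ)
    (P : Protocol H D) (ω : Instance V D) (y : Fin T → ZMod 2) : ℝ :=
  prob ε (fun ω' => xorPrefix ω' = y ∧ SameView P ω ω') / prob ε (fun ω' => SameView P ω ω')

/-- Total variation distance of a distribution on `{0,1}^T` from the uniform one. -/
noncomputable def tvFromUniform (p : (Fin T → ZMod 2) → ℝ) : ℝ :=
  (1 / 2) * ∑ y, |p y - 1 / 2 ^ T|

/-- A decision rule of the referee: from all messages, all permutations and a string in `{0,1}^T`,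
it outputs a guess for the repeated bit of `τ`. -/
abbrev Referee (V : Type*) (D : Layout E n T) : Type _ :=
  (E → List Bool) → (∀ e, Equiv.Perm {m // m ∈ D.L e}) →
    (V → Equiv.Perm (Fin (numLabels E n T))) → (Fin T → ZMod 2) → ZMod 2

/-- The probability, under the hard distribution, that the referee, given the messages, the
permutations and `τ ⊕ ⨁ₑ xₑ^{1:T}`, guesses `τ` correctly. -/
noncomputable def successProb {H : MultiHypergraph V E} {D : Layout E n T} (ε : ℝ)
    (P : Protocol H D) (G : Referee V D) : ℝ :=
  prob ε (fun ω => G (messages P ω) ω.permE ω.permV (fun j => ω.tau + xorPrefix ω j) = ω.tau)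

end CountingGame

/-- The sign character of `ZMod 2`. -/
def bitSign (b : ZMod 2) : ℝ := if b = 0 then 1 else -1

theorem bitSign_add (a b : ZMod 2) : bitSign (a + b) = bitSign a * bitSign b := by
  have h : (1 : ZMod 2) + 1 = 0 := by decide
  have h2 : ∀ c : ZMod 2, c = 0 ∨ c = 1 := by decide
  rcases h2 a with rfl | rfl <;> rcases h2 b with rfl | rfl <;> simp [bitSign, h]

theorem bitSign_sq (a : ZMod 2) : bitSign a ^ 2 = 1 := by
  unfold bitSign; split_ifs <;> norm_num

theorem abs_bitSign (a : ZMod 2) : |bitSign a| = 1 := by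
  unfold bitSign; split_ifs <;> norm_num

section Walsh

variable {ι : Type*}

/-- The Walsh character of the cube `{0,1}^ι` with index set `s`. -/
def walsh (s : Finset ι) (x : ι → ZMod 2) : ℝ := ∏ i ∈ s, bitSign (x i)

@[simp] theorem walsh_empty (x : ι → ZMod 2) : walsh ∅ x = 1 := by simp [walsh]

theorem walsh_add (s : Finset ι) (x y : ι → ZMod 2) :
    walsh s (x + y) = walsh s x * walsh s y := by
  simp [walsh, bitSign_add, prod_mul_distrib]

theorem abs_walsh (s : Finset ι) (x : ι → ZMod 2) : |walsh s x| = 1 := by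
  simp [walsh, abs_prod, abs_bitSign]

theorem walsh_sum {κ : Type*} (t : Finset κ) (s : Finset ι) (x : κ → ι → ZMod 2) :
    walsh s (fun i => ∑ e ∈ t, x e i) = ∏ e ∈ t, walsh s (x e) := by
  classical
  induction t using Finset.induction_on with
  | empty => simp [walsh, bitSign]
  | insert a t ha ih =>
    rw [prod_insert ha, ← ih, ← walsh_add]
    congr 1
    funext i
    simp [sum_insert ha]

theorem walsh_map {κ : Type*} (f : κ ↪ ι) (s : Finset κ) (x : ι → ZMod 2) :
    walsh (s.map f) x = walsh s (fun j => x (f j)) := by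
  simp [walsh]

theorem sum_range_even_add_odd (f : ℕ → ℝ) (m : ℕ) :
    ∑ i ∈ range (2 * m + 1), f i
      = ∑ j ∈ range (m + 1), f (2 * j) + ∑ j ∈ range m, f (2 * j + 1) := by
  induction m with
  | zero => simp
  | succ m ih =>
    rw [show 2 * (m + 1) + 1 = 2 * m + 1 + 1 + 1 by ring, sum_range_succ, sum_range_succ, ih,
      sum_range_succ (fun j => f (2 * j)) (m + 1), sum_range_succ (fun j => f (2 * j + 1)) m,
      show 2 * (m + 1) = 2 * m + 1 + 1 by ring]
    ring

theorem choose_two_mul_le (m j : ℕ) (hj : j ≤ m) (hm : 1 ≤ m) :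
    (2 * m).choose (2 * j) ≤ m.choose j * (2 * m - 1) ^ j := by
  induction j with
  | zero => simp
  | succ j ih =>
    have ih := ih (by omega)
    have h1 := Nat.choose_succ_right_eq (2 * m) (2 * j)
    have h2 := Nat.choose_succ_right_eq (2 * m) (2 * j + 1)
    have h3 := Nat.choose_succ_right_eq m j
    obtain ⟨d, rfl⟩ : ∃ d, m = j + 1 + d := ⟨m - (j + 1), by omega⟩
    rw [show 2 * (j + 1 + d) - 2 * j = 2 * d + 2 by omega] at h1
    rw [show 2 * (j + 1 + d) - (2 * j + 1) = 2 * d + 1 by omega] at h2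
    rw [show j + 1 + d - j = d + 1 by omega] at h3
    rw [show 2 * (j + 1) = 2 * j + 1 + 1 by ring]
    have hq : 2 * (j + 1 + d) - 1 = 2 * j + 2 * d + 1 := by omega
    rw [hq] at ih ⊢
    set A := (2 * (j + 1 + d)).choose (2 * j)
    set B := (2 * (j + 1 + d)).choose (2 * j + 1)
    set C := (2 * (j + 1 + d)).choose (2 * j + 1 + 1)
    set K := (j + 1 + d).choose j
    set L := (j + 1 + d).choose (j + 1)
    have key : C * ((2 * j + 1) * (2 * (j + 1))) = A * (2 * (d + 1)) * (2 * d + 1) := by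
      calc C * ((2 * j + 1) * (2 * (j + 1))) = (C * (2 * j + 1 + 1)) * (2 * j + 1) := by ring
        _ = (B * (2 * j + 1)) * (2 * d + 1) := by rw [h2]; ring
        _ = _ := by rw [h1]; ring
    have hpos : 0 < (2 * j + 1) * (2 * (j + 1)) := by positivity
    refine Nat.le_of_mul_le_mul_right ?_ hpos
    rw [key]
    calc A * (2 * (d + 1)) * (2 * d + 1)
        ≤ (K * (2 * j + 2 * d + 1) ^ j) * (2 * (d + 1)) * (2 * j + 2 * d + 1) := by
          gcongr; omega
      _ = (K * (d + 1)) * 2 * (2 * j + 2 * d + 1) ^ (j + 1) := by ring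
      _ = (L * (j + 1)) * 2 * (2 * j + 2 * d + 1) ^ (j + 1) := by rw [h3]
      _ = (L * (2 * j + 2 * d + 1) ^ (j + 1)) * (1 * (2 * (j + 1))) := by ring
      _ ≤ _ := by gcongr; omega

theorem two_point_inequality (m : ℕ) (hm : 1 ≤ m) (g h : ℝ) :
    ((g + h) ^ (2 * m) + (g - h) ^ (2 * m)) / 2 ≤ (g ^ 2 + (2 * m - 1) * h ^ 2) ^ m := by
  have e1 : (g + h) ^ (2 * m) + (g - h) ^ (2 * m)
      = 2 * ∑ j ∈ range (m + 1), h ^ (2 * j) * g ^ (2 * m - 2 * j) * (2 * m).choose (2 * j) := by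
    rw [add_comm g h, show g - h = -h + g by ring, add_pow, add_pow, sum_range_even_add_odd,
      sum_range_even_add_odd]
    have : ∀ j, (-h) ^ (2 * j + 1) = - h ^ (2 * j + 1) := fun j => by
      rw [Odd.neg_pow ⟨j, rfl⟩]
    simp only [this, Even.neg_pow (even_two_mul _), neg_mul, sum_neg_distrib]
    ring
  rw [e1, add_comm (g ^ 2), add_pow]
  rw [mul_div_cancel_left₀ _ (two_ne_zero)]
  refine sum_le_sum fun j hj => ?_
  have hjm : j ≤ m := by simpa [Nat.lt_succ_iff] using hj
  have hc : ((2 * m).choose (2 * j) : ℝ) ≤ m.choose j * (2 * m - 1) ^ j := by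
    have := choose_two_mul_le m j hjm hm
    have h2 : ((2 * m - 1 : ℕ) : ℝ) = 2 * m - 1 := by
      rw [Nat.cast_sub (by omega)]; push_cast; ring
    rw [← h2]
    exact_mod_cast this
  have e2 : g ^ (2 * m - 2 * j) = (g ^ 2) ^ (m - j) := by
    rw [← pow_mul, Nat.mul_sub]
  have e3 : h ^ (2 * j) = (h ^ 2) ^ j := by rw [← pow_mul]
  rw [e2, e3, mul_pow]
  calc (h ^ 2) ^ j * (g ^ 2) ^ (m - j) * (2 * m).choose (2 * j)
      ≤ (h ^ 2) ^ j * (g ^ 2) ^ (m - j) * (m.choose j * (2 * m - 1) ^ j) := by gcongr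
    _ = _ := by ring

variable [DecidableEq ι]

theorem walsh_add_single_of_notMem {i : ι} {s : Finset ι} (hi : i ∉ s) (x : ι → ZMod 2)
    (b : ZMod 2) : walsh s (x + Pi.single i b) = walsh s x := by
  refine prod_congr rfl fun j hj => ?_
  have : j ≠ i := fun h => hi (h ▸ hj)
  simp [this]

variable [Fintype ι]

/-- Minkowski's inequality for uniform averages and natural exponents. -/
theorem sum_add_pow_le {α : Type*} (s : Finset α) (m : ℕ) (hm : 1 ≤ m) (u v : α → ℝ)
    (hu : ∀ a, 0 ≤ u a) (hv : ∀ a, 0 ≤ v a) {N A B : ℝ} (hN : 0 ≤ N) (hA : 0 ≤ A) (hB : 0 ≤ B)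
    (h1 : ∑ a ∈ s, u a ^ m ≤ N * A ^ m) (h2 : ∑ a ∈ s, v a ^ m ≤ N * B ^ m) :
    ∑ a ∈ s, (u a + v a) ^ m ≤ N * (A + B) ^ m := by
  have hm' : (m : ℝ) ≠ 0 := by positivity
  have key := Real.Lp_add_le_of_nonneg s (p := (m : ℝ)) (f := u) (g := v) (by exact_mod_cast hm)
    (fun i _ => hu i) (fun i _ => hv i)
  simp only [Real.rpow_natCast] at key
  have root : ∀ C : ℝ, 0 ≤ C → (N * C ^ m) ^ (1 / (m : ℝ)) = N ^ (1 / (m : ℝ)) * C := by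
    intro C hC
    rw [Real.mul_rpow hN (by positivity), ← Real.rpow_natCast C, ← Real.rpow_mul hC,
      mul_one_div_cancel hm', Real.rpow_one]
  have hS : 0 ≤ ∑ a ∈ s, (u a + v a) ^ m :=
    sum_nonneg fun a _ => pow_nonneg (add_nonneg (hu a) (hv a)) _
  have h3 : (∑ a ∈ s, (u a + v a) ^ m) ^ (1 / (m : ℝ)) ≤ (N * (A + B) ^ m) ^ (1 / (m : ℝ)) := by
    rw [root _ (add_nonneg hA hB), mul_add, ← root A hA, ← root B hB]
    refine key.trans (add_le_add ?_ ?_)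
    · exact Real.rpow_le_rpow (sum_nonneg fun a _ => pow_nonneg (hu a) _) h1 (by positivity)
    · exact Real.rpow_le_rpow (sum_nonneg fun a _ => pow_nonneg (hv a) _) h2 (by positivity)
  exact (Real.rpow_le_rpow_iff hS (by positivity) (by positivity)).1 h3

/-- Bonami's inequality: the `L^{2m}` norm of a polynomial on the cube is at most the `L^2` norm of
its image under the operator that scales the `k`-th level by `(2m-1)^{k/2}`. -/
theorem bonami_aux (m : ℕ) (hm : 1 ≤ m) (t : Finset ι) (a : Finset ι → ℝ) :
    ∑ x : ι → ZMod 2, (∑ s ∈ t.powerset, a s * walsh s x) ^ (2 * m)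
      ≤ Fintype.card (ι → ZMod 2) * (∑ s ∈ t.powerset, (2 * m - 1) ^ #s * a s ^ 2) ^ m := by
  have hm1 : (0 : ℝ) ≤ 2 * m - 1 := by
    have : (1 : ℝ) ≤ m := by exact_mod_cast hm
    linarith
  induction t using Finset.induction_on generalizing a with
  | empty => simp [pow_mul]
  | insert i t hi ih =>
    set g : (ι → ZMod 2) → ℝ := fun x => ∑ s ∈ t.powerset, a s * walsh s x with hg
    set h : (ι → ZMod 2) → ℝ := fun x => ∑ s ∈ t.powerset, a (insert i s) * walsh s x with hh
    have hmem : ∀ s ∈ t.powerset, i ∉ s := fun s hs hi' => hi (mem_powerset.1 hs hi')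
    have e : ∀ x, ∑ s ∈ (insert i t).powerset, a s * walsh s x
        = g x + bitSign (x i) * h x := by
      intro x
      rw [sum_powerset_insert hi, hg, hh]
      simp only [mul_sum]
      congr 1
      refine sum_congr rfl fun s hs => ?_
      rw [walsh, prod_insert (hmem s hs)]
      simp only [walsh]
      ring
    have hgi : ∀ x, g (x + Pi.single i 1) = g x := fun x =>
      sum_congr rfl fun s hs => by rw [walsh_add_single_of_notMem (hmem s hs)]
    have hhi : ∀ x, h (x + Pi.single i 1) = h x := fun x =>
      sum_congr rfl fun s hs => by rw [walsh_add_single_of_notMem (hmem s hs)]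
    have hflip : ∑ x, (g x + bitSign (x i) * h x) ^ (2 * m)
        = ∑ x, (g x - bitSign (x i) * h x) ^ (2 * m) := by
      rw [← Equiv.sum_comp (Equiv.addRight (Pi.single i (1 : ZMod 2) : ι → ZMod 2))]
      refine sum_congr rfl fun x _ => ?_
      simp only [Equiv.coe_addRight, hgi, hhi, Pi.add_apply, Pi.single_eq_same, bitSign_add]
      simp [bitSign]
      ring
    have hpt : ∀ x : ι → ZMod 2,
        ((g x + bitSign (x i) * h x) ^ (2 * m) + (g x - bitSign (x i) * h x) ^ (2 * m)) / 2
          ≤ (g x ^ 2 + (2 * m - 1) * h x ^ 2) ^ m := by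
      intro x
      refine (two_point_inequality m hm _ _).trans_eq ?_
      rw [mul_pow, bitSign_sq, one_mul]
    have h1 : ∑ x, (g x ^ 2) ^ m ≤ Fintype.card (ι → ZMod 2) *
        (∑ s ∈ t.powerset, (2 * m - 1 : ℝ) ^ #s * a s ^ 2) ^ m := by
      simp only [← pow_mul]
      exact ih a
    have h2 : ∑ x, ((2 * m - 1) * h x ^ 2) ^ m ≤ Fintype.card (ι → ZMod 2) *
        (∑ s ∈ t.powerset, (2 * m - 1 : ℝ) ^ (#s + 1) * a (insert i s) ^ 2) ^ m := by
      have := ih (fun s => a (insert i s))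
      simp only [mul_pow, ← pow_mul, ← mul_sum]
      simp only [pow_succ (2 * (m : ℝ) - 1), mul_comm _ (2 * (m : ℝ) - 1), mul_assoc, ← mul_sum,
        mul_pow]
      rw [mul_left_comm]
      exact mul_le_mul_of_nonneg_left this (pow_nonneg hm1 _)
    have h3 := sum_add_pow_le univ m hm (fun x => g x ^ 2) (fun x => (2 * m - 1) * h x ^ 2)
      (fun _ => by positivity) (fun _ => by positivity) (by positivity)
      (sum_nonneg fun _ _ => by positivity) (sum_nonneg fun _ _ => by positivity) h1 h2
    simp only [e]
    rw [sum_powerset_insert hi]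
    have hcard : ∀ s ∈ t.powerset, (2 * m - 1 : ℝ) ^ #(insert i s) * a (insert i s) ^ 2
        = (2 * m - 1 : ℝ) ^ (#s + 1) * a (insert i s) ^ 2 := fun s hs => by
      rw [card_insert_of_notMem (hmem s hs)]
    rw [sum_congr rfl hcard]
    refine le_trans ?_ h3
    calc ∑ x, (g x + bitSign (x i) * h x) ^ (2 * m)
        = ∑ x, ((g x + bitSign (x i) * h x) ^ (2 * m)
            + (g x - bitSign (x i) * h x) ^ (2 * m)) / 2 := by
          rw [← sum_div, sum_add_distrib, ← hflip]; ring
      _ ≤ _ := sum_le_sum fun x _ => hpt x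

theorem bonami_level (m : ℕ) (hm : 1 ≤ m) (k : ℕ) (a : Finset ι → ℝ) :
    ∑ x : ι → ZMod 2, (∑ s ∈ univ.powersetCard k, a s * walsh s x) ^ (2 * m)
      ≤ Fintype.card (ι → ZMod 2) *
        ((2 * m - 1) ^ k * ∑ s ∈ univ.powersetCard k, a s ^ 2) ^ m := by
  have h := bonami_aux m hm (univ : Finset ι) (fun s => if #s = k then a s else 0)
  have e : (univ : Finset ι).powersetCard k = univ.powerset.filter (fun s => #s = k) := by
    ext s; simp [mem_powersetCard]
  rw [e, mul_sum]
  simp only [sum_filter]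
  convert h using 4 with x _ s hs
  · split_ifs <;> simp
  · split_ifs with h <;> simp [h]

end Walsh

section CondWalsh

variable {ι : Type*} [Fintype ι] [DecidableEq ι] {M : Type*} [DecidableEq M]

/-- The points of the cube on which `φ` has the same value as at `x`. -/
def fibre (φ : (ι → ZMod 2) → M) (x : ι → ZMod 2) : Finset (ι → ZMod 2) :=
  univ.filter fun x' => φ x' = φ x

/-- The conditional expectation of a Walsh character given the value of `φ`. -/
noncomputable def condWalsh (φ : (ι → ZMod 2) → M) (s : Finset ι) (x : ι → ZMod 2) : ℝ :=
  (∑ x' ∈ fibre φ x, walsh s x') / #(fibre φ x)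

/-- The mean square of the conditional expectation of a Walsh character given `φ`. -/
noncomputable def condEnergy (φ : (ι → ZMod 2) → M) (s : Finset ι) : ℝ :=
  (∑ x, condWalsh φ s x ^ 2) / Fintype.card (ι → ZMod 2)

theorem fibre_card_pos (φ : (ι → ZMod 2) → M) (x : ι → ZMod 2) : (0 : ℝ) < #(fibre φ x) := by
  exact_mod_cast card_pos.2 ⟨x, by simp [fibre]⟩

theorem abs_condWalsh_le_one (φ : (ι → ZMod 2) → M) (s : Finset ι) (x : ι → ZMod 2) :
    |condWalsh φ s x| ≤ 1 := by
  have h := fibre_card_pos φ x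
  rw [condWalsh, abs_div, abs_of_pos h, div_le_one h]
  refine (abs_sum_le_sum_abs _ _).trans ?_
  simp [abs_walsh]

theorem condEnergy_nonneg (φ : (ι → ZMod 2) → M) (s : Finset ι) : 0 ≤ condEnergy φ s := by
  unfold condEnergy; positivity

theorem condEnergy_le_one (φ : (ι → ZMod 2) → M) (s : Finset ι) : condEnergy φ s ≤ 1 := by
  rw [condEnergy, div_le_one (by positivity)]
  refine (sum_le_sum fun x _ => (sq_le_one_iff_abs_le_one _).2 (abs_condWalsh_le_one φ s x)).trans ?_
  rw [sum_const, nsmul_one, card_univ]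

/-- The level-`k` inequality for one fibre. -/
theorem level_inequality_fibre (φ : (ι → ZMod 2) → M) (k m : ℕ) (hm : 1 ≤ m) (x : ι → ZMod 2) :
    (∑ s ∈ univ.powersetCard k, condWalsh φ s x ^ 2) ^ m
      ≤ ((2 * m - 1) ^ k) ^ m * (Fintype.card (ι → ZMod 2) / #(fibre φ x)) := by
  have hm1 : (0 : ℝ) ≤ 2 * m - 1 := by
    have : (1 : ℝ) ≤ m := by exact_mod_cast hm
    linarith
  set A := fibre φ x with hA
  have ha : (0 : ℝ) < #A := fibre_card_pos φ x
  set W := ∑ s ∈ univ.powersetCard k, condWalsh φ s x ^ 2 with hW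
  have hW0 : 0 ≤ W := sum_nonneg fun _ _ => sq_nonneg _
  rcases hW0.eq_or_lt with h0 | hpos
  · rw [← h0, zero_pow (by omega)]
    positivity
  set F : (ι → ZMod 2) → ℝ := fun y => ∑ s ∈ univ.powersetCard k, condWalsh φ s x * walsh s y
  have h1 : ∑ y ∈ A, F y = #A * W := by
    rw [sum_comm, hW, mul_sum]
    refine sum_congr rfl fun s _ => ?_
    rw [← mul_sum]
    have : ∑ y ∈ A, walsh s y = #A * condWalsh φ s x := by
      rw [condWalsh, mul_div_cancel₀ _ ha.ne']
    rw [this]; ring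
  have h2 : (#A * W) ^ (2 * m) ≤ #A ^ (2 * m - 1) * ∑ y ∈ A, F y ^ (2 * m) := by
    have h := pow_sum_div_card_le_sum_pow (s := A) (f := fun y => |F y|)
      (fun _ _ => abs_nonneg _) (2 * m - 1)
    rw [Nat.sub_add_cancel (by omega), div_le_iff₀ (by positivity)] at h
    simp only [Even.pow_abs (even_two_mul m)] at h
    rw [mul_comm (_ ^ _)]
    refine le_trans ?_ h
    rw [← h1]
    exact (Even.pow_abs (even_two_mul m) _).symm.le.trans
      (pow_le_pow_left₀ (abs_nonneg _) (abs_sum_le_sum_abs _ _) _)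
  have h3 : ∑ y ∈ A, F y ^ (2 * m)
      ≤ Fintype.card (ι → ZMod 2) * ((2 * m - 1) ^ k * W) ^ m :=
    (sum_le_univ_sum_of_nonneg fun y => (even_two_mul m).pow_nonneg _).trans
      (bonami_level m hm k _)
  have h4 := h2.trans (mul_le_mul_of_nonneg_left h3 (by positivity))
  have hp : 0 < (#A : ℝ) ^ (2 * m) * W ^ m := by positivity
  rw [← mul_div_assoc, le_div_iff₀ ha]
  refine le_of_mul_le_mul_left ?_ (show 0 < (#A : ℝ) ^ (2 * m - 1) * W ^ m by positivity)
  have e : (#A : ℝ) ^ (2 * m) = #A ^ (2 * m - 1) * #A := by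
    rw [← pow_succ, Nat.sub_add_cancel (by omega)]
  calc (#A : ℝ) ^ (2 * m - 1) * W ^ m * (W ^ m * #A) = (#A * W) ^ (2 * m) := by
        rw [mul_pow, e, two_mul, pow_add W]; ring
    _ ≤ _ := h4
    _ = _ := by rw [mul_pow]; ring

theorem sum_card_div_card_fibre (φ : (ι → ZMod 2) → M) :
    ∑ x, (1 : ℝ) / #(fibre φ x) = #(univ.image φ) := by
  rw [← sum_fiberwise_of_maps_to (t := univ.image φ) (g := φ) (fun x _ => mem_image_of_mem _ (mem_univ x))]
  rw [card_eq_sum_ones, Nat.cast_sum]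
  refine sum_congr rfl fun y hy => ?_
  obtain ⟨x, -, rfl⟩ := mem_image.1 hy
  have : ∀ x' ∈ univ.filter (fun x' => φ x' = φ x), (1 : ℝ) / #(fibre φ x') = 1 / #(fibre φ x) := by
    intro x' hx'
    rw [fibre, fibre, (mem_filter.1 hx').2]
  rw [sum_congr rfl this, sum_const, nsmul_eq_mul]
  have := (fibre_card_pos φ x).ne'
  rw [fibre] at this ⊢
  field_simp
  simp

/-- The level-`k` inequality for functions with few values, on average over the fibres. -/
theorem level_inequality (φ : (ι → ZMod 2) → M) (k m : ℕ) (hm : 1 ≤ m)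
    (hφ : #(univ.image φ) ≤ 2 ^ (k * m)) :
    ∑ s ∈ univ.powersetCard k, condEnergy φ s ≤ (2 * (2 * m - 1)) ^ k := by
  have hm1 : (0 : ℝ) ≤ 2 * m - 1 := by
    have : (1 : ℝ) ≤ m := by exact_mod_cast hm
    linarith
  set N : ℝ := ((Fintype.card (ι → ZMod 2) : ℕ) : ℝ) with hN
  have hNpos : 0 < N := by positivity
  have e : ∑ s ∈ univ.powersetCard k, condEnergy φ s
      = ∑ x, 1 / N * ∑ s ∈ univ.powersetCard k, condWalsh φ s x ^ 2 := by
    simp only [condEnergy, ← hN, ← sum_div]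
    rw [sum_comm, ← mul_sum]
    ring
  rw [e]
  refine le_of_pow_le_pow_left₀ (n := m) (by omega) (by positivity) ?_
  refine (Real.pow_arith_mean_le_arith_mean_pow univ _ _ (fun _ _ => by positivity) ?_
    (fun _ _ => by positivity) m).trans ?_
  · rw [sum_const, card_univ, nsmul_eq_mul, ← hN]
    field_simp
  calc ∑ x, 1 / N * (∑ s ∈ univ.powersetCard k, condWalsh φ s x ^ 2) ^ m
      ≤ ∑ x, 1 / N * (((2 * m - 1) ^ k) ^ m * (N / #(fibre φ x))) := by
        gcongr with x
        exact level_inequality_fibre φ k m hm x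
    _ = ∑ x, ((2 * m - 1) ^ k) ^ m * ((1 : ℝ) / #(fibre φ x)) := by
        refine sum_congr rfl fun x _ => ?_
        have := (fibre_card_pos φ x).ne'
        field_simp
    _ = ((2 * m - 1) ^ k) ^ m * #(univ.image φ) := by
        rw [← mul_sum, sum_card_div_card_fibre]
    _ ≤ ((2 * m - 1) ^ k) ^ m * 2 ^ (k * m) := by
        gcongr
        exact_mod_cast hφ
    _ = _ := by rw [mul_pow, mul_pow, pow_mul]; ring

/-- Permuting the coordinates permutes the conditional energies. -/
theorem condEnergy_comp_perm (φ : (ι → ZMod 2) → M) (κ : Equiv.Perm ι) (s : Finset ι) :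
    condEnergy (fun x => φ (x ∘ κ)) (s.map κ.toEmbedding) = condEnergy φ s := by
  let E : (ι → ZMod 2) ≃ (ι → ZMod 2) := Equiv.arrowCongr κ.symm (Equiv.refl _)
  have hE : ∀ x, E x = x ∘ κ := fun x => rfl
  have hw : ∀ x, walsh (s.map κ.toEmbedding) x = walsh s (E x) := fun x => by
    rw [walsh_map]; rfl
  have hf : ∀ x, fibre φ (E x) = (fibre (fun x => φ (x ∘ κ)) x).map E.toEmbedding := by
    intro x
    ext y
    simp only [fibre, mem_filter, mem_univ, true_and, mem_map_equiv, ← hE, Equiv.apply_symm_apply]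
  unfold condEnergy
  congr 1
  rw [← Equiv.sum_comp E (fun x => condWalsh φ s x ^ 2)]
  refine sum_congr rfl fun x _ => ?_
  rw [condWalsh, condWalsh, hf, card_map, sum_map]
  simp only [hw]
  rfl

end CondWalsh

/-- There are at most `2^(c+1)` bit strings of length at most `c`. -/
theorem card_le_of_length_le (S : Finset (List Bool)) (c : ℕ) (h : ∀ l ∈ S, l.length ≤ c) :
    #S ≤ 2 ^ (c + 1) := by
  have hsub : S ⊆ (range (c + 1)).biUnion
      fun i => (univ : Finset (List.Vector Bool i)).image List.Vector.toList := by
    intro l hl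
    rw [mem_biUnion]
    exact ⟨l.length, mem_range.2 (Nat.lt_succ_of_le (h l hl)),
      mem_image.2 ⟨⟨l, rfl⟩, mem_univ _, rfl⟩⟩
  refine (card_le_card hsub).trans (card_biUnion_le.trans ?_)
  calc ∑ i ∈ range (c + 1), #((univ : Finset (List.Vector Bool i)).image List.Vector.toList)
      ≤ ∑ i ∈ range (c + 1), 2 ^ i := by
        refine sum_le_sum fun i _ => card_image_le.trans ?_
        simp
    _ ≤ 2 ^ (c + 1) := (Nat.geomSum_lt le_rfl (by simp)).le

/-- Hölder's inequality for uniform averages of several functions, with weights of sum at most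
one. -/
theorem avg_prod_rpow_le {α J : Type*} [Fintype α] [Nonempty α] (s : Finset J) (h : J → α → ℝ)
    (w : J → ℝ) (hh : ∀ j a, 0 ≤ h j a) (hw : ∀ j, 0 ≤ w j) (hw1 : ∑ j ∈ s, w j ≤ 1) :
    (∑ a, ∏ j ∈ s, h j a ^ w j) / Fintype.card α
      ≤ ∏ j ∈ s, ((∑ a, h j a) / Fintype.card α) ^ w j := by
  set N : ℝ := ((Fintype.card α : ℕ) : ℝ) with hN
  have hNpos : 0 < N := by positivity
  set A : J → ℝ := fun j => (∑ a, h j a) / N with hA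
  have hA0 : ∀ j, 0 ≤ A j := fun j => div_nonneg (sum_nonneg fun a _ => hh j a) hNpos.le
  have hRHS : 0 ≤ ∏ j ∈ s, A j ^ w j := prod_nonneg fun j _ => Real.rpow_nonneg (hA0 j) _
  by_cases hz : ∃ j ∈ s, A j = 0 ∧ w j ≠ 0
  · obtain ⟨j, hj, hAj, hwj⟩ := hz
    have hj0 : ∀ a, h j a = 0 := by
      have : ∑ a, h j a = 0 := by simpa [hA, hNpos.ne'] using hAj
      exact fun a => (sum_eq_zero_iff_of_nonneg fun a _ => hh j a).1 this a (mem_univ a)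
    have : ∀ a, ∏ j ∈ s, h j a ^ w j = 0 := fun a =>
      prod_eq_zero hj (by rw [hj0, Real.zero_rpow hwj])
    simpa [this] using hRHS
  push Not at hz
  have hfac : ∀ a, ∏ j ∈ s, h j a ^ w j = (∏ j ∈ s, A j ^ w j) * ∏ j ∈ s, (h j a / A j) ^ w j := by
    intro a
    rw [← prod_mul_distrib]
    refine prod_congr rfl fun j hj => ?_
    by_cases h0 : A j = 0
    · simp [hz j hj h0]
    · rw [← Real.mul_rpow (hA0 j) (div_nonneg (hh j a) (hA0 j)), mul_div_cancel₀ _ h0]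
  have hamgm : ∀ a, ∏ j ∈ s, (h j a / A j) ^ w j
      ≤ (1 - ∑ j ∈ s, w j) + ∑ j ∈ s, w j * (h j a / A j) := by
    intro a
    have := Real.geom_mean_le_arith_mean_weighted s.insertNone
      (fun o => o.elim (1 - ∑ j ∈ s, w j) w) (fun o => o.elim 1 fun j => h j a / A j)
      (by rintro (_ | j) _ <;> simp [hw, hw1]) (by simp [sum_insertNone])
      (by rintro (_ | j) _ <;> simp [hh, hA0, div_nonneg])
    simpa [sum_insertNone, prod_insertNone] using this
  simp only [hfac, ← mul_sum]
  rw [mul_div_assoc]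
  refine mul_le_of_le_one_right hRHS ?_
  rw [div_le_one hNpos]
  refine (sum_le_sum fun a _ => hamgm a).trans ?_
  rw [sum_add_distrib, sum_const, card_univ, nsmul_eq_mul, ← hN, sum_comm]
  have : ∀ j ∈ s, ∑ a, w j * (h j a / A j) ≤ w j * N := by
    intro j hj
    rw [← mul_sum, ← sum_div]
    refine mul_le_mul_of_nonneg_left ?_ (hw j)
    have e : ∑ a, h j a = A j * N := by rw [hA]; field_simp
    rw [e]
    by_cases h0 : A j = 0
    · simp [h0, hNpos.le]
    · rw [mul_div_cancel_left₀ _ h0]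
  have := sum_le_sum this
  rw [← sum_mul] at this
  nlinarith

section Finner

variable {I : Type*} [DecidableEq I] {Ω : I → Type*} [∀ i, Fintype (Ω i)]

/-- The average of a function on a finite product over one of its coordinates. -/
noncomputable def avgAt (i : I) (F : (∀ i, Ω i) → ℝ) (x : ∀ i, Ω i) : ℝ :=
  (∑ a, F (Function.update x i a)) / Fintype.card (Ω i)

theorem sum_avgAt [Fintype I] [∀ i, Nonempty (Ω i)] (i : I) (F : (∀ i, Ω i) → ℝ) :
    ∑ x, avgAt i F x = ∑ x, F x := by
  let g : (∀ i, Ω i) × Ω i → (∀ i, Ω i) × Ω i := fun p => (Function.update p.1 i p.2, p.1 i)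
  have hg : Function.Involutive g := fun p => by simp [g]
  have h : ∑ p : (∀ i, Ω i) × Ω i, F (g p).1 = ∑ p : (∀ i, Ω i) × Ω i, F p.1 :=
    Equiv.sum_comp hg.toPerm (fun p : (∀ i, Ω i) × Ω i => F p.1)
  rw [Fintype.sum_prod_type, Fintype.sum_prod_type] at h
  simp only [avgAt, ← sum_div]
  simp only [g, sum_const, card_univ, nsmul_eq_mul, ← mul_sum] at h
  rw [h, mul_div_cancel_left₀]
  positivity

theorem avgAt_prod_rpow_le [∀ i, Nonempty (Ω i)] {J : Type*} [Fintype J] (D : J → Finset I)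
    (h : J → (∀ i, Ω i) → ℝ) (hh : ∀ j x, 0 ≤ h j x)
    (hD : ∀ j x x', (∀ i ∈ D j, x i = x' i) → h j x = h j x') (y : J → ℝ) (hy : ∀ j, 0 ≤ y j)
    (i : I) (hsum : ∑ j with i ∈ D j, y j ≤ 1) (x : ∀ i, Ω i) :
    avgAt i (fun x => ∏ j, h j x ^ y j) x ≤ ∏ j, avgAt i (h j) x ^ y j := by
  have hconst : ∀ j, i ∉ D j → ∀ a, h j (Function.update x i a) = h j x := by
    intro j hj a
    refine hD j _ _ fun k hk => ?_
    rw [Function.update_of_ne]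
    rintro rfl
    exact hj hk
  have hconst' : ∀ j, i ∉ D j → avgAt i (h j) x = h j x := by
    intro j hj
    simp [avgAt, hconst j hj]
  rw [avgAt]
  simp only [← prod_filter_mul_prod_filter_not univ (fun j => i ∈ D j)]
  have e1 : ∀ a, ∏ j with i ∉ D j, h j (Function.update x i a) ^ y j
      = ∏ j with i ∉ D j, h j x ^ y j := fun a =>
    prod_congr rfl fun j hj => by rw [hconst j (mem_filter.1 hj).2]
  have e2 : ∏ j with i ∉ D j, avgAt i (h j) x ^ y j = ∏ j with i ∉ D j, h j x ^ y j :=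
    prod_congr rfl fun j hj => by rw [hconst' j (mem_filter.1 hj).2]
  simp only [e1, e2]
  rw [← sum_mul, mul_div_right_comm]
  refine mul_le_mul_of_nonneg_right ?_ (prod_nonneg fun j _ => Real.rpow_nonneg (hh j x) _)
  exact avg_prod_rpow_le _ (fun j a => h j (Function.update x i a)) y (fun _ _ => hh _ _) hy hsum

/-- Finner's inequality: Hölder's inequality for functions on a finite product, each depending on
some of the coordinates, with weights forming a fractional matching. -/
theorem finner_inequality [Fintype I] [∀ i, Nonempty (Ω i)] {J : Type*} [Fintype J] (D : J → Finset I)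
    (h : J → (∀ i, Ω i) → ℝ) (hh : ∀ j x, 0 ≤ h j x)
    (hD : ∀ j x x', (∀ i ∈ D j, x i = x' i) → h j x = h j x') (y : J → ℝ) (hy : ∀ j, 0 ≤ y j)
    (hsum : ∀ i, ∑ j with i ∈ D j, y j ≤ 1) :
    (∑ x, ∏ j, h j x ^ y j) / Fintype.card (∀ i, Ω i)
      ≤ ∏ j, ((∑ x, h j x) / Fintype.card (∀ i, Ω i)) ^ y j := by
  suffices H : ∀ (S : Finset I) (D : J → Finset I) (h : J → (∀ i, Ω i) → ℝ),
      (∀ j x, 0 ≤ h j x) → (∀ j x x', (∀ i ∈ D j, x i = x' i) → h j x = h j x') →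
      (∀ i, ∑ j with i ∈ D j, y j ≤ 1) → (∀ j, D j ⊆ S) →
      (∑ x, ∏ j, h j x ^ y j) / Fintype.card (∀ i, Ω i)
        ≤ ∏ j, ((∑ x, h j x) / Fintype.card (∀ i, Ω i)) ^ y j from
    H univ D h hh hD hsum fun j => subset_univ _
  intro S
  induction S using Finset.induction_on with
  | empty =>
    intro D h hh hD _ hS
    obtain ⟨x₀⟩ : Nonempty (∀ i, Ω i) := inferInstance
    have hc : ∀ j x, h j x = h j x₀ := fun j x =>
      hD j x x₀ fun i hi => absurd (hS j hi) (notMem_empty i)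
    simp only [fun j x => hc j x, sum_const, nsmul_eq_mul]
    rw [card_univ]
    have : ((Fintype.card (∀ i, Ω i) : ℕ) : ℝ) ≠ 0 := by positivity
    simp only [mul_div_cancel_left₀ _ this, le_refl]
  | insert i S hi ih =>
    intro D h hh hD hsum hS
    have key := ih (fun j => (D j).erase i) (fun j => avgAt i (h j))
      (fun j x => div_nonneg (sum_nonneg fun _ _ => hh _ _) (by positivity))
      (fun j x x' hx => by
        unfold avgAt
        congr 1
        refine sum_congr rfl fun a _ => hD j _ _ fun k hk => ?_
        by_cases hki : k = i
        · subst hki; simp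
        · simp [hki, hx k (mem_erase.2 ⟨hki, hk⟩)])
      (fun k => (sum_le_sum_of_subset_of_nonneg (fun j hj => by
          simp only [mem_filter, mem_univ, true_and] at hj ⊢
          exact (mem_erase.1 hj).2) (fun j _ _ => hy j)).trans (hsum k))
      (fun j => by
        intro k hk
        obtain ⟨hki, hk⟩ := mem_erase.1 hk
        exact (mem_insert.1 (hS j hk)).resolve_left hki)
    simp only [sum_avgAt] at key
    refine le_trans ?_ key
    rw [← sum_avgAt i (fun x => ∏ j, h j x ^ y j)]
    refine div_le_div_of_nonneg_right (sum_le_sum fun x _ => ?_) (by positivity)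
    exact avgAt_prod_rpow_le D h hh hD y hy i (hsum i) x

end Finner

namespace MultiHypergraph

variable {V E : Type*} [Fintype V] [Fintype E]

theorem MVC_one_le_of_cover (H : MultiHypergraph V E) {f : V → ℝ} {g : E → ℝ} (hf : ∀ v, 0 ≤ f v)
    (hg : ∀ e, 0 ≤ g e) (hc : ∀ e, 1 ≤ ∑ v ∈ H.verts e, f v + g e) :
    H.MVC 1 ≤ ∑ v, f v + ∑ e, g e := by
  refine csInf_le ⟨0, ?_⟩ ⟨f, g, hf, hg, hc, by rw [one_mul]⟩
  rintro r ⟨f, g, hf, hg, -, rfl⟩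
  rw [one_mul]
  exact add_nonneg (sum_nonneg fun v _ => hf v) (sum_nonneg fun e _ => hg e)

theorem one_le_MVC_one [Nonempty E] (H : MultiHypergraph V E) : 1 ≤ H.MVC 1 := by
  refine le_csInf ⟨_, 0, 1, fun _ => le_rfl, fun _ => zero_le_one, fun e => by simp, rfl⟩ ?_
  rintro r ⟨f, g, hf, hg, hc, rfl⟩
  obtain ⟨e⟩ := ‹Nonempty E›
  rw [one_mul]
  exact (hc e).trans (add_le_add (sum_le_univ_sum_of_nonneg hf)
    (single_le_sum (fun e _ => hg e) (mem_univ e)))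

variable [DecidableEq V] [DecidableEq E]

/-- The incidence vector of an edge, extended by a private vertex for every edge. -/
def incidence (H : MultiHypergraph V E) (e : E) : V ⊕ E → ℝ :=
  Sum.elim (fun v => if v ∈ H.verts e then 1 else 0) (Pi.single e 1)

/-- Linear programming duality for the modified fractional vertex cover number: there is a
fractional matching of the same total weight. -/
theorem exists_fractional_matching [Nonempty E] (H : MultiHypergraph V E) :
    ∃ y : E → ℝ, (∀ e, 0 ≤ y e) ∧ (∀ e, y e ≤ 1) ∧ (∀ v, ∑ e with v ∈ H.verts e, y e ≤ 1) ∧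
      ∑ e, y e = H.MVC 1 := by
  set μ := H.MVC 1 with hμ
  have hμ1 : 1 ≤ μ := H.one_le_MVC_one
  have hμ0 : 0 < μ := by linarith
  let K : Set (V ⊕ E → ℝ) := (fun y : E → ℝ => ∑ e, y e • H.incidence e) '' stdSimplex ℝ E
  let C : Set (V ⊕ E → ℝ) := Set.Iic fun _ => 1 / μ
  have hKc : IsCompact K := (isCompact_stdSimplex ℝ E).image (by fun_prop)
  have hKconv : Convex ℝ K :=
    (convex_stdSimplex ℝ E).is_linear_image ⟨fun a b => by simp [add_smul, sum_add_distrib],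
      fun c a => by simp [mul_smul, smul_sum]⟩
  suffices hne : ¬ Disjoint C K by
    obtain ⟨z, hzC, y, hy, rfl⟩ := Set.not_disjoint_iff.1 hne
    have hle : ∀ i, (∑ e, y e • H.incidence e) i ≤ 1 / μ := hzC
    have hle' : ∀ i, ∑ e, (μ * y e) * H.incidence e i ≤ 1 := by
      intro i
      have := hle i
      rw [Finset.sum_apply, le_div_iff₀ hμ0, mul_comm, mul_sum] at this
      simpa [mul_assoc] using this
    refine ⟨fun e => μ * y e, fun e => mul_nonneg hμ0.le (hy.1 e), fun e => ?_, fun v => ?_, ?_⟩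
    · have := hle' (Sum.inr e)
      simpa [incidence, Pi.single_apply] using this
    · have := hle' (Sum.inl v)
      simpa [incidence, sum_filter] using this
    · rw [← mul_sum, hy.2, mul_one]
  intro hdisj
  obtain ⟨F, u, v, hFC, huv, hFK⟩ :=
    geometric_hahn_banach_closed_compact (convex_Iic _) isClosed_Iic hKconv hKc hdisj
  set w : V ⊕ E → ℝ := fun i => F (Pi.single i 1) with hw
  have hF : ∀ z, F z = ∑ i, z i * w i := fun z => by
    have hz : z = ∑ i, z i • Pi.single i (1 : ℝ) := by
      ext j
      simp only [Finset.sum_apply, Pi.smul_apply, Pi.single_apply, smul_eq_mul, mul_ite, mul_one,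
        mul_zero, sum_ite_eq, mem_univ, if_true]
    conv_lhs => rw [hz]
    simp only [map_sum, map_smul, smul_eq_mul, hw]
  have hw0 : ∀ i, 0 ≤ w i := by
    intro i
    by_contra hneg
    push Not at hneg
    have hN : 0 ≤ |u| / (-w i) := div_nonneg (abs_nonneg _) (by linarith)
    have h1 := hFC (Pi.single i (-(|u| / (-w i)))) (by
      intro j
      by_cases hj : j = i
      · subst hj
        simp only [Pi.single_eq_same]
        have : 0 ≤ 1 / μ := by positivity
        linarith
      · simp only [Pi.single_eq_of_ne hj]
        positivity)
    rw [hF] at h1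
    simp only [Pi.single_apply, ite_mul, zero_mul, sum_ite_eq', mem_univ, if_true] at h1
    have : -(|u| / (-w i)) * w i = |u| := by
      have := hneg.ne
      field_simp
    rw [this] at h1
    exact absurd h1 (not_lt.2 (le_abs_self u))
  have hu := hFC (fun _ => 1 / μ) Set.self_mem_Iic
  rw [hF, ← mul_sum] at hu
  have hsum0 : 0 ≤ ∑ i, w i := sum_nonneg fun i _ => hw0 i
  have hu0 : 0 < u := lt_of_le_of_lt (by positivity) hu
  have hcov : ∀ e, u ≤ ∑ v ∈ H.verts e, w (Sum.inl v) + w (Sum.inr e) := by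
    intro e
    have h1 := hFK (H.incidence e) ⟨Pi.single e 1, single_mem_stdSimplex ℝ e, by
      simp [Pi.single_apply]⟩
    rw [hF, Fintype.sum_sum_type] at h1
    simp [incidence, Pi.single_apply] at h1
    linarith
  have hle := H.MVC_one_le_of_cover (f := fun v => w (Sum.inl v) / u)
    (g := fun e => w (Sum.inr e) / u) (fun v => div_nonneg (hw0 _) hu0.le)
    (fun e => div_nonneg (hw0 _) hu0.le) (fun e => by
      rw [← sum_div, ← add_div, le_div_iff₀ hu0, one_mul]
      exact hcov e)
  rw [← sum_div, ← sum_div, ← add_div, ← Fintype.sum_sum_type, le_div_iff₀ hu0, ← hμ] at hle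
  have : 1 / μ * ∑ i, w i < u := hu
  rw [one_div, inv_mul_lt_iff₀ hμ0] at this
  linarith

end MultiHypergraph

namespace CountingGame

variable {V E : Type*} [Fintype V] [DecidableEq V] [Fintype E] [DecidableEq E] {n T : ℕ}

/-- All permutations drawn in an instance. -/
abbrev Perms (V : Type*) (D : Layout E n T) : Type _ :=
  (∀ e, Equiv.Perm {m // m ∈ D.L e}) × (V → Equiv.Perm (Fin (numLabels E n T)))

/-- The message of player `e` as a function of the noisy string, for fixed permutations. -/
def msgFun {H : MultiHypergraph V E} {D : Layout E n T} (P : Protocol H D) (e : E)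
    (θ : Perms V D) (z : Fin n → ZMod 2) : List Bool :=
  P e (fun i => z ((D.ρ e).symm ((θ.1 e).symm i)), fun v i => θ.2 v.val ((θ.1 e).symm i).val)

/-- The joint distribution of the clean and the noisy string of one edge, with correlation `η`. -/
noncomputable def edgeWeight (η : ℝ) (z : (Fin n → ZMod 2) × (Fin n → ZMod 2)) : ℝ :=
  (2 ^ n)⁻¹ * ∏ i, if z.2 i = z.1 i then 1 - (1 / 2 - η / 2) else 1 / 2 - η / 2

/-- The instance with given strings, permutations and bit. -/
def mkInstance {D : Layout E n T} (z : E → (Fin n → ZMod 2) × (Fin n → ZMod 2)) (θ : Perms V D)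
    (b : ZMod 2) : Instance V D :=
  ⟨fun e => (z e).1, fun e => (z e).2, θ.1, θ.2, b⟩

/-- Instances are triples of the strings of every edge, the permutations and the bit. -/
def tripleEquiv (V : Type*) (D : Layout E n T) :
    (Perms V D × ZMod 2 × (E → (Fin n → ZMod 2) × (Fin n → ZMod 2))) ≃ Instance V D where
  toFun t := mkInstance t.2.2 t.1 t.2.1
  invFun ω := ((ω.permE, ω.permV), ω.tau, fun e => (ω.x e, ω.xt e))
  left_inv _ := rfl
  right_inv _ := rfl

theorem hardProb_mkInstance {D : Layout E n T} (ε : ℝ)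
    (z : E → (Fin n → ZMod 2) × (Fin n → ZMod 2)) (θ : Perms V D) (b : ZMod 2) :
    hardProb ε (mkInstance z θ b) = (Fintype.card (Perms V D) : ℝ)⁻¹ * (1 / 2) *
      ∏ e, edgeWeight (ε ^ (1 / (Fintype.card E : ℝ))) (z e) := by
  have hc : Fintype.card (E → Fin n → ZMod 2) = (2 ^ n) ^ Fintype.card E := by
    simp [ZMod.card]
  rw [hardProb, hc, Fintype.card_prod]
  simp only [edgeWeight, prod_mul_distrib, mkInstance, prod_const, card_univ, Nat.cast_mul,
    mul_inv, Nat.cast_pow, Nat.cast_ofNat, inv_pow]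
  ring_nf

theorem expect_eq {D : Layout E n T} (ε : ℝ) (X : Instance V D → ℝ) :
    expect ε X = (Fintype.card (Perms V D) : ℝ)⁻¹ * ∑ θ : Perms V D, ∑ b : ZMod 2, 1 / 2 *
      ∑ z : E → (Fin n → ZMod 2) × (Fin n → ZMod 2),
        (∏ e, edgeWeight (ε ^ (1 / (Fintype.card E : ℝ))) (z e)) * X (mkInstance z θ b) := by
  rw [expect, ← Equiv.sum_comp (tripleEquiv V D), Fintype.sum_prod_type, mul_sum]
  refine sum_congr rfl fun θ _ => ?_
  rw [Fintype.sum_prod_type, mul_sum]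
  refine sum_congr rfl fun b _ => ?_
  rw [mul_sum, mul_sum]
  refine sum_congr rfl fun z _ => ?_
  change hardProb ε (mkInstance z θ b) * X (mkInstance z θ b) = _
  rw [hardProb_mkInstance]
  ring

theorem sum_edgeWeight_mul_walsh (η : ℝ) (s : Finset (Fin n)) (y : Fin n → ZMod 2) :
    ∑ x, edgeWeight η (x, y) * walsh s x = (2 ^ n)⁻¹ * (η ^ #s * walsh s y) := by
  have h1 : ∀ x : Fin n → ZMod 2, edgeWeight η (x, y) * walsh s x = (2 ^ n)⁻¹ *
      ∏ i, ((if y i = x i then 1 - (1 / 2 - η / 2) else 1 / 2 - η / 2) *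
        (if i ∈ s then bitSign (x i) else 1)) := by
    intro x
    rw [prod_mul_distrib, edgeWeight, walsh, prod_ite_mem, univ_inter]
    ring
  simp only [h1, ← mul_sum]
  congr 1
  have h2 : ∀ i : Fin n, ∑ b : ZMod 2, ((if y i = b then 1 - (1 / 2 - η / 2) else 1 / 2 - η / 2) *
      (if i ∈ s then bitSign b else 1)) = if i ∈ s then η * bitSign (y i) else 1 := by
    intro i
    have hu : (univ : Finset (ZMod 2)) = {0, 1} := by decide
    have hb : y i = 0 ∨ y i = 1 := by
      have : ∀ c : ZMod 2, c = 0 ∨ c = 1 := by decide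
      exact this _
    rw [hu, sum_pair (by decide)]
    rcases hb with hb | hb <;> rw [hb] <;> split_ifs <;> simp_all [bitSign] <;> ring_nf
  rw [← Fintype.prod_sum fun (i : Fin n) (b : ZMod 2) =>
    ((if y i = b then 1 - (1 / 2 - η / 2) else 1 / 2 - η / 2) *
      (if i ∈ s then bitSign b else 1))]
  simp only [h2]
  rw [prod_ite_mem, univ_inter, prod_mul_distrib, prod_const, walsh]

theorem sum_edgeWeight_snd (η : ℝ) (F : (Fin n → ZMod 2) → ℝ) :
    ∑ z, edgeWeight η z * F z.2 = (2 ^ n)⁻¹ * ∑ y : Fin n → ZMod 2, F y := by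
  rw [Fintype.sum_prod_type, sum_comm, mul_sum]
  refine sum_congr rfl fun y _ => ?_
  have := sum_edgeWeight_mul_walsh η ∅ y
  simp only [walsh_empty, mul_one, card_empty, pow_zero] at this
  dsimp only
  rw [← sum_mul, this]

theorem expect_prod_xt {D : Layout E n T} (ε : ℝ) (F : E → Perms V D → (Fin n → ZMod 2) → ℝ) :
    expect ε (fun ω : Instance V D => ∏ e, F e (ω.permE, ω.permV) (ω.xt e))
      = (Fintype.card (Perms V D) : ℝ)⁻¹ * ∑ θ : Perms V D, ∏ e, ((2 ^ n)⁻¹ * ∑ y, F e θ y) := by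
  rw [expect_eq]
  congr 1
  refine sum_congr rfl fun θ _ => ?_
  have : ∀ b : ZMod 2, ∑ z : E → (Fin n → ZMod 2) × (Fin n → ZMod 2),
      (∏ e, edgeWeight (ε ^ (1 / (Fintype.card E : ℝ))) (z e)) *
        ∏ e, F e θ ((mkInstance z θ b).xt e) = ∏ e, ((2 ^ n)⁻¹ * ∑ y, F e θ y) := by
    intro b
    simp only [← prod_mul_distrib, ← sum_edgeWeight_snd (ε ^ (1 / (Fintype.card E : ℝ)))]
    rw [Fintype.prod_sum]
    rfl
  change ∑ b : ZMod 2, 1 / 2 * ∑ z : E → (Fin n → ZMod 2) × (Fin n → ZMod 2),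
      (∏ e, edgeWeight (ε ^ (1 / (Fintype.card E : ℝ))) (z e)) *
        ∏ e, F e θ ((mkInstance z θ b).xt e) = _
  simp only [this, sum_const, card_univ, ZMod.card]
  rw [nsmul_eq_mul]
  push_cast
  ring

open Classical in
theorem expect_sameView {H : MultiHypergraph V E} {D : Layout E n T} (ε : ℝ) (P : Protocol H D)
    (ω : Instance V D) (G : E → (Fin n → ZMod 2) → ℝ) :
    expect ε (fun ω' => if SameView P ω ω' then ∏ e, G e (ω'.x e) else 0)
      = (Fintype.card (Perms V D) : ℝ)⁻¹ * ∏ e,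
        ∑ y ∈ fibre (msgFun P e (ω.permE, ω.permV)) (ω.xt e),
          ∑ x, edgeWeight (ε ^ (1 / (Fintype.card E : ℝ))) (x, y) * G e x := by
  rw [expect_eq]
  congr 1
  set η := ε ^ (1 / (Fintype.card E : ℝ))
  rw [sum_eq_single (ω.permE, ω.permV)]
  · have : ∀ b : ZMod 2, ∑ z : E → (Fin n → ZMod 2) × (Fin n → ZMod 2),
        (∏ e, edgeWeight η (z e)) *
          (if SameView P ω (mkInstance z (ω.permE, ω.permV) b)
            then ∏ e, G e ((mkInstance z (ω.permE, ω.permV) b).x e) else 0)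
        = ∏ e, ∑ y ∈ fibre (msgFun P e (ω.permE, ω.permV)) (ω.xt e),
          ∑ x, edgeWeight η (x, y) * G e x := by
      intro b
      have e1 : ∀ e, ∑ y ∈ fibre (msgFun P e (ω.permE, ω.permV)) (ω.xt e),
          ∑ x, edgeWeight η (x, y) * G e x = ∑ z : (Fin n → ZMod 2) × (Fin n → ZMod 2),
            edgeWeight η z * (if msgFun P e (ω.permE, ω.permV) z.2
              = msgFun P e (ω.permE, ω.permV) (ω.xt e) then G e z.1 else 0) := by
        intro e
        symm
        rw [Fintype.sum_prod_type, sum_comm, fibre, sum_filter]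
        refine sum_congr rfl fun y _ => ?_
        split_ifs <;> simp
      simp only [e1]
      rw [Fintype.prod_sum]
      refine sum_congr rfl fun z _ => ?_
      rw [prod_mul_distrib]
      congr 1
      by_cases hs : ∀ e, msgFun P e (ω.permE, ω.permV) (z e).2
          = msgFun P e (ω.permE, ω.permV) (ω.xt e)
      · rw [if_pos ⟨rfl, rfl, funext hs⟩]
        simp only [hs, if_true]
        rfl
      · rw [if_neg fun h => hs fun e => congrFun h.2.2 e]
        push Not at hs
        obtain ⟨e, he⟩ := hs
        exact (prod_eq_zero (mem_univ e) (by rw [if_neg he])).symm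
    simp only [this, sum_const, card_univ, ZMod.card]
    rw [nsmul_eq_mul]
    push_cast
    ring
  · intro θ _ hθ
    have : ∀ b z, ¬ SameView P ω (mkInstance z θ b) := fun b z h =>
      hθ (Prod.ext h.1 h.2.1)
    simp [this]
  · simp

theorem prob_sameView {H : MultiHypergraph V E} {D : Layout E n T} (ε : ℝ) (P : Protocol H D)
    (ω : Instance V D) :
    prob ε (fun ω' => SameView P ω ω') = (Fintype.card (Perms V D) : ℝ)⁻¹ * ∏ e,
      ((2 ^ n)⁻¹ * #(fibre (msgFun P e (ω.permE, ω.permV)) (ω.xt e)) : ℝ) := by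
  have h := expect_sameView ε P ω (fun _ x => walsh ∅ x)
  simp only [sum_edgeWeight_mul_walsh] at h
  simp only [walsh_empty, prod_const_one, card_empty, pow_zero, mul_one, sum_const,
    nsmul_eq_mul] at h
  rw [prob, h]
  simp only [mul_comm]

theorem prob_sameView_pos {H : MultiHypergraph V E} {D : Layout E n T} (ε : ℝ) (P : Protocol H D)
    (ω : Instance V D) : 0 < prob ε (fun ω' => SameView P ω ω') := by
  rw [prob_sameView]
  refine mul_pos (by positivity) (prod_pos fun e _ => mul_pos (by positivity) ?_)
  exact fibre_card_pos _ _

theorem sum_mul_posterior {H : MultiHypergraph V E} {D : Layout E n T} (ε : ℝ) (P : Protocol H D)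
    (ω : Instance V D) (f : (Fin T → ZMod 2) → ℝ) [DecidablePred (SameView P ω)] :
    ∑ y, f y * posterior ε P ω y
      = expect ε (fun ω' => if SameView P ω ω' then f (xorPrefix ω') else 0) /
        prob ε (fun ω' => SameView P ω ω') := by
  classical
  simp only [posterior, ← mul_div_assoc, ← sum_div]
  congr 1
  simp only [prob, expect, mul_sum]
  rw [sum_comm]
  refine sum_congr rfl fun ω' _ => ?_
  rw [sum_eq_single (xorPrefix ω')]
  · by_cases h : SameView P ω ω' <;> simp [h, mul_comm]
  · intro y _ hy
    simp [Ne.symm hy]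
  · simp

theorem sum_posterior {H : MultiHypergraph V E} {D : Layout E n T} (ε : ℝ) (P : Protocol H D)
    (ω : Instance V D) : ∑ y, posterior ε P ω y = 1 := by
  classical
  have h := sum_mul_posterior ε P ω (fun _ => 1)
  simp only [one_mul] at h
  rw [h, div_eq_one_iff_eq (prob_sameView_pos ε P ω).ne', prob]

/-- The Fourier coefficients of the posterior are products of conditional Walsh characters. -/
theorem posterior_fourier [Nonempty E] {H : MultiHypergraph V E} {D : Layout E n T} {ε : ℝ}
    (hε : 0 ≤ ε) (P : Protocol H D) (ω : Instance V D) (s : Finset (Fin T)) :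
    ∑ y, walsh s y * posterior ε P ω y = ε ^ #s * ∏ e,
      condWalsh (msgFun P e (ω.permE, ω.permV)) (s.map (Fin.castLEEmb D.T_le)) (ω.xt e) := by
  classical
  rw [sum_mul_posterior, prob_sameView]
  have hx : ∀ ω' : Instance V D, walsh s (xorPrefix ω')
      = ∏ e, walsh (s.map (Fin.castLEEmb D.T_le)) (ω'.x e) := by
    intro ω'
    simp only [walsh_map]
    exact walsh_sum univ s fun e j => ω'.x e (Fin.castLE D.T_le j)
  simp only [hx]
  have h := expect_sameView ε P ω (fun _ x => walsh (s.map (Fin.castLEEmb D.T_le)) x)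
  simp only [sum_edgeWeight_mul_walsh, card_map, ← mul_sum] at h
  have hη : (ε ^ (1 / (Fintype.card E : ℝ))) ^ Fintype.card E = ε := by
    rw [← Real.rpow_natCast, ← Real.rpow_mul hε, one_div_mul_cancel (by positivity),
      Real.rpow_one]
  refine (congrArg (· / _) h).trans ?_
  rw [mul_div_mul_left _ _ (by positivity), ← prod_div_distrib]
  simp only [condWalsh]
  have : ε ^ #s = ∏ _e : E, (ε ^ (1 / (Fintype.card E : ℝ))) ^ #s := by
    rw [prod_const, card_univ, ← pow_mul, mul_comm, pow_mul, hη]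
  rw [this, ← prod_mul_distrib]
  refine prod_congr rfl fun e _ => ?_
  rw [mul_div_mul_left _ _ (by positivity), mul_div_assoc]

end CountingGame

theorem exists_perm_map_eq {ι : Type*} [Fintype ι] [DecidableEq ι] {s t : Finset ι}
    (h : #s = #t) : ∃ κ : Equiv.Perm ι, s.map κ.toEmbedding = t := by
  let e := Finset.equivOfCardEq h
  refine ⟨e.extendSubtype, eq_of_subset_of_card_le (fun x hx => ?_) (by rw [card_map, h])⟩
  obtain ⟨y, hy, rfl⟩ := mem_map.1 hx
  exact e.extendSubtype_mem y hy

namespace CountingGame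

variable {V E : Type*} [Fintype V] [DecidableEq V] [Fintype E] [DecidableEq E] {n T : ℕ}

/-- The permutations by which one multiplies in order to relabel the string of the edge `e`. -/
def relabelPerms (V : Type*) (D : Layout E n T) (e : E) (κ : Equiv.Perm (Fin n)) : Perms V D :=
  (Pi.mulSingle e ((D.ρ e).permCongr κ), fun _ => Equiv.Perm.ofSubtype ((D.ρ e).permCongr κ))

omit [Fintype V] [DecidableEq V] in
theorem msgFun_mul_relabelPerms {H : MultiHypergraph V E} {D : Layout E n T} (P : Protocol H D)
    (e : E) (θ : Perms V D) (κ : Equiv.Perm (Fin n)) :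
    msgFun P e (θ * relabelPerms V D e κ) = fun z => msgFun P e θ (z ∘ (κ⁻¹ : Equiv.Perm (Fin n))) := by
  funext z
  have h : ∀ i, ((θ * relabelPerms V D e κ).1 e).symm i
      = ((D.ρ e).permCongr κ).symm ((θ.1 e).symm i) := by
    intro i
    simp [relabelPerms, ← Equiv.Perm.inv_def, mul_inv_rev, Equiv.Perm.mul_apply]
  unfold msgFun
  congr 1
  refine Prod.ext ?_ ?_
  · funext i
    simp only [h, Function.comp_apply]
    congr 1
    change (D.ρ e).symm ((D.ρ e) (κ.symm ((D.ρ e).symm ((θ.1 e).symm i)))) = _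
    rw [Equiv.symm_apply_apply]
    rfl
  · funext v i
    simp only [h]
    change θ.2 v.val (Equiv.Perm.ofSubtype ((D.ρ e).permCongr κ)
      (((D.ρ e).permCongr κ).symm ((θ.1 e).symm i) : {m // m ∈ D.L e}).val) = _
    rw [Equiv.Perm.ofSubtype_apply_coe, Equiv.apply_symm_apply]

/-- The average over all permutations of the energy captured by the message of a player. -/
noncomputable def avgEnergy {H : MultiHypergraph V E} {D : Layout E n T} (P : Protocol H D)
    (e : E) (s : Finset (Fin n)) : ℝ :=
  (∑ θ : Perms V D, condEnergy (msgFun P e θ) s) / Fintype.card (Perms V D)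

theorem avgEnergy_nonneg {H : MultiHypergraph V E} {D : Layout E n T} (P : Protocol H D)
    (e : E) (s : Finset (Fin n)) : 0 ≤ avgEnergy P e s :=
  div_nonneg (sum_nonneg fun _ _ => condEnergy_nonneg _ _) (by positivity)

theorem avgEnergy_map {H : MultiHypergraph V E} {D : Layout E n T} (P : Protocol H D)
    (e : E) (s : Finset (Fin n)) (κ : Equiv.Perm (Fin n)) :
    avgEnergy P e (s.map κ.toEmbedding) = avgEnergy P e s := by
  unfold avgEnergy
  congr 1
  rw [← Equiv.sum_comp (Equiv.mulRight (relabelPerms V D e κ⁻¹))]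
  refine sum_congr rfl fun θ _ => ?_
  rw [Equiv.coe_mulRight, msgFun_mul_relabelPerms, inv_inv, condEnergy_comp_perm]

omit [Fintype V] [DecidableEq V] [DecidableEq E] in
theorem card_image_msgFun_le {H : MultiHypergraph V E} {D : Layout E n T} {P : Protocol H D}
    {c : ℕ} (hP : P.AtMostBits c) (e : E) (θ : Perms V D) :
    #(univ.image (msgFun P e θ)) ≤ 2 ^ (c + 1) := by
  refine card_le_of_length_le _ c fun l hl => ?_
  obtain ⟨z, -, rfl⟩ := mem_image.1 hl
  exact hP (mkInstance (fun _ => (0, z)) θ 0) e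

theorem avgEnergy_le {H : MultiHypergraph V E} {D : Layout E n T} {P : Protocol H D}
    {c : ℕ} (hP : P.AtMostBits c) (e : E) (s : Finset (Fin n)) (m : ℕ) (hm : 1 ≤ m)
    (hk : c + 1 ≤ #s * m) : avgEnergy P e s ≤ (2 * (2 * m - 1)) ^ #s / n.choose #s := by
  have hsn : #s ≤ n := by simpa using card_le_univ s
  have hpos : (0 : ℝ) < n.choose #s := by exact_mod_cast Nat.choose_pos hsn
  rw [le_div_iff₀ hpos]
  have h1 : avgEnergy P e s * n.choose #s = ∑ t ∈ univ.powersetCard #s, avgEnergy P e t := by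
    rw [sum_congr rfl (g := fun _ => avgEnergy P e s), sum_const, card_powersetCard, card_univ,
      Fintype.card_fin, nsmul_eq_mul, mul_comm]
    intro t ht
    obtain ⟨κ, rfl⟩ := exists_perm_map_eq (mem_powersetCard.1 ht).2.symm
    exact avgEnergy_map P e s κ
  rw [h1]
  simp only [avgEnergy, ← sum_div]
  rw [sum_comm, div_le_iff₀ (by positivity)]
  calc ∑ θ : Perms V D, ∑ t ∈ univ.powersetCard #s, condEnergy (msgFun P e θ) t
      ≤ ∑ _θ : Perms V D, (2 * (2 * (m : ℝ) - 1)) ^ #s := by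
        refine sum_le_sum fun θ _ => level_inequality _ _ m hm ?_
        exact (card_image_msgFun_le hP e θ).trans (Nat.pow_le_pow_right (by norm_num) hk)
    _ = _ := by rw [sum_const, card_univ, nsmul_eq_mul, mul_comm]

/-- The type of the permutation attached to a vertex or an edge. -/
abbrev PermAt (V : Type*) (D : Layout E n T) : V ⊕ E → Type
  | Sum.inl _ => Equiv.Perm (Fin (numLabels E n T))
  | Sum.inr e => Equiv.Perm {m // m ∈ D.L e}

instance (D : Layout E n T) : ∀ i, Fintype (PermAt V D i)
  | Sum.inl _ => inferInstanceAs (Fintype (Equiv.Perm (Fin (numLabels E n T))))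
  | Sum.inr e => inferInstanceAs (Fintype (Equiv.Perm {m // m ∈ D.L e}))

instance (D : Layout E n T) : ∀ i, Nonempty (PermAt V D i)
  | Sum.inl _ => inferInstanceAs (Nonempty (Equiv.Perm (Fin (numLabels E n T))))
  | Sum.inr e => inferInstanceAs (Nonempty (Equiv.Perm {m // m ∈ D.L e}))

/-- All permutations as one family over the vertices and edges. -/
def permsEquiv (V : Type*) (D : Layout E n T) : (∀ i, PermAt V D i) ≃ Perms V D where
  toFun x := (fun e => x (Sum.inr e), fun v => x (Sum.inl v))
  invFun θ := Sum.rec θ.2 θ.1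
  left_inv x := by funext i; cases i <;> rfl
  right_inv _ := rfl

/-- The energies captured by all players are jointly at most as if they were independent along a
fractional matching. -/
theorem avg_prod_condEnergy_le [Nonempty E] {H : MultiHypergraph V E} {D : Layout E n T}
    (P : Protocol H D) (s : Finset (Fin n)) (A : ℝ) (hA : ∀ e, avgEnergy P e s ≤ A) :
    (∑ θ : Perms V D, ∏ e, condEnergy (msgFun P e θ) s) / Fintype.card (Perms V D)
      ≤ A ^ H.MVC 1 := by
  obtain ⟨y, hy0, hy1, hyv, hysum⟩ := H.exists_fractional_matching
  have hA0 : 0 ≤ A := by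
    obtain ⟨e⟩ := ‹Nonempty E›
    exact (avgEnergy_nonneg P e s).trans (hA e)
  have hfin := finner_inequality (Ω := PermAt V D)
    (fun e => insert (Sum.inr e) ((H.verts e).map Function.Embedding.inl))
    (fun e x => condEnergy (msgFun P e (permsEquiv V D x)) s)
    (fun e x => condEnergy_nonneg _ _)
    (fun e x x' h => by
      have h1 : x (Sum.inr e) = x' (Sum.inr e) := h _ (mem_insert_self _ _)
      have h2 : ∀ v ∈ H.verts e, x (Sum.inl v) = x' (Sum.inl v) := fun v hv =>
        h _ (mem_insert_of_mem (mem_map_of_mem Function.Embedding.inl hv))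
      have : msgFun P e (permsEquiv V D x) = msgFun P e (permsEquiv V D x') := by
        funext z
        simp only [msgFun, permsEquiv, Equiv.coe_fn_mk]
        rw [h1]
        congr 1
        refine Prod.ext rfl ?_
        funext v i
        change x (Sum.inl v.val) _ = x' (Sum.inl v.val) _
        rw [h2 v.val v.property]
      simp only [this])
    y hy0 (by
      rintro (v | e)
      · convert hyv v using 2
        ext e
        simp
      · have : (univ.filter fun e' => (Sum.inr e : V ⊕ E) ∈ insert (Sum.inr e')
            ((H.verts e').map Function.Embedding.inl)) = {e} := by
          ext e'
          simp [eq_comm]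
        rw [this, sum_singleton]
        exact hy1 e)
  rw [Fintype.card_congr (permsEquiv V D)] at hfin
  rw [Equiv.sum_comp (permsEquiv V D) fun θ => ∏ e, condEnergy (msgFun P e θ) s ^ y e] at hfin
  simp only [fun e => Equiv.sum_comp (permsEquiv V D) fun θ => condEnergy (msgFun P e θ) s] at hfin
  calc (∑ θ : Perms V D, ∏ e, condEnergy (msgFun P e θ) s) / Fintype.card (Perms V D)
      ≤ (∑ θ : Perms V D, ∏ e, condEnergy (msgFun P e θ) s ^ y e) / Fintype.card (Perms V D) := by
        refine div_le_div_of_nonneg_right (sum_le_sum fun θ _ => prod_le_prod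
          (fun e _ => condEnergy_nonneg _ _) fun e _ => ?_) (by positivity)
        exact Real.self_le_rpow_of_le_one (condEnergy_nonneg _ _) (condEnergy_le_one _ _) (hy1 e)
    _ ≤ ∏ e, avgEnergy P e s ^ y e := hfin
    _ ≤ ∏ e, A ^ y e := prod_le_prod (fun e _ => Real.rpow_nonneg (avgEnergy_nonneg P e s) _)
        fun e _ => Real.rpow_le_rpow (avgEnergy_nonneg P e s) (hA e) (hy0 e)
    _ = A ^ H.MVC 1 := by
        rw [← hysum, Real.rpow_sum_of_nonneg hA0 fun e _ => hy0 e]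

end CountingGame

theorem sum_walsh_mul_walsh {ι : Type*} [Fintype ι] [DecidableEq ι] (y z : ι → ZMod 2) :
    ∑ s : Finset ι, walsh s y * walsh s z = if y = z then 2 ^ Fintype.card ι else 0 := by
  have h2 : ∀ c : ZMod 2, c = 0 ∨ c = 1 := by decide
  simp only [← walsh_add]
  rw [← powerset_univ]
  unfold walsh
  rw [← prod_one_add]
  split_ifs with h
  · subst h
    have : ∀ i, (y + y) i = 0 := fun i => CharTwo.add_self_eq_zero (y i)
    simp only [this, bitSign, if_true, prod_const, card_univ]
    norm_num
  · obtain ⟨i, hi⟩ := Function.ne_iff.1 h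
    refine prod_eq_zero (mem_univ i) ?_
    have : (y + z) i = 1 := by
      rw [Pi.add_apply]
      refine (h2 _).resolve_left fun h0 => hi ?_
      rwa [CharTwo.add_eq_zero] at h0
    rw [this]
    simp [bitSign]

/-- Parseval's identity on the cube. -/
theorem sum_sq_walsh_coeff {ι : Type*} [Fintype ι] [DecidableEq ι] (q : (ι → ZMod 2) → ℝ) :
    ∑ s : Finset ι, (∑ y, walsh s y * q y) ^ 2 = 2 ^ Fintype.card ι * ∑ y, q y ^ 2 := by
  simp only [sq (∑ y, _), sum_mul_sum]
  rw [sum_comm, mul_sum]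
  refine sum_congr rfl fun y _ => ?_
  rw [sum_comm]
  have : ∀ z, ∑ s : Finset ι, walsh s y * q y * (walsh s z * q z)
      = q y * q z * if y = z then 2 ^ Fintype.card ι else 0 := by
    intro z
    rw [← sum_walsh_mul_walsh, mul_sum]
    exact sum_congr rfl fun s _ => by ring
  simp only [this, mul_ite, mul_zero, sum_ite_eq, mem_univ, if_true]
  ring

theorem sum_walsh_eq_zero {ι : Type*} [Fintype ι] [DecidableEq ι] {s : Finset ι}
    (hs : s.Nonempty) : ∑ y, walsh s y = 0 := by
  obtain ⟨i, hi⟩ := hs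
  have h : ∑ y, walsh s y = ∑ y, -walsh s y := by
    rw [← Equiv.sum_comp (Equiv.addRight (Pi.single i (1 : ZMod 2) : ι → ZMod 2))]
    refine sum_congr rfl fun y _ => ?_
    have : walsh s (Pi.single i (1 : ZMod 2)) = -1 := by
      rw [walsh, ← mul_prod_erase s _ hi, prod_eq_one]
      · simp [bitSign]
      · intro j hj
        simp [(mem_erase.1 hj).1, bitSign]
    rw [Equiv.coe_addRight, walsh_add, this, mul_neg_one]
  rw [sum_neg_distrib] at h
  linarith

namespace CountingGame

/-- The total variation distance from the uniform distribution is bounded by the nontrivial Fourier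
coefficients. -/
theorem four_mul_tvFromUniform_sq_le {T : ℕ} (p : (Fin T → ZMod 2) → ℝ) (hp : ∑ y, p y = 1) :
    4 * tvFromUniform p ^ 2 ≤ ∑ s ∈ univ.erase ∅, (∑ y, walsh s y * p y) ^ 2 := by
  set q : (Fin T → ZMod 2) → ℝ := fun y => p y - 1 / 2 ^ T with hq
  have hcard : (#(univ : Finset (Fin T → ZMod 2)) : ℝ) = 2 ^ T := by
    simp [card_univ, ZMod.card]
  have h1 : 4 * tvFromUniform p ^ 2 = (∑ y, |q y|) ^ 2 := by
    rw [tvFromUniform]; ring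
  have h2 : (∑ y, |q y|) ^ 2 ≤ 2 ^ T * ∑ y, q y ^ 2 := by
    have := sq_sum_le_card_mul_sum_sq (s := univ) (f := fun y => |q y|)
    simpa only [hcard, sq_abs] using this
  have h3 := sum_sq_walsh_coeff q
  rw [Fintype.card_fin] at h3
  rw [h1]
  refine h2.trans ?_
  rw [← h3, ← add_sum_erase _ _ (mem_univ ∅)]
  have h0 : ∑ y, walsh ∅ y * q y = 0 := by
    simp only [walsh_empty, one_mul, hq, sum_sub_distrib, hp, sum_const, nsmul_eq_mul, hcard]
    field_simp
    simp
  rw [h0, zero_pow two_ne_zero, zero_add]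
  refine (sum_congr rfl fun s hs => ?_).le
  congr 1
  simp only [hq, mul_sub, sum_sub_distrib, ← sum_mul]
  rw [sum_walsh_eq_zero (nonempty_iff_ne_empty.2 (mem_erase.1 hs).1)]
  ring

theorem tvFromUniform_le_one {T : ℕ} (p : (Fin T → ZMod 2) → ℝ) (hp : ∑ y, p y = 1)
    (h0 : ∀ y, 0 ≤ p y) : tvFromUniform p ≤ 1 := by
  have hcard : (#(univ : Finset (Fin T → ZMod 2)) : ℝ) = 2 ^ T := by
    simp [card_univ, ZMod.card]
  have : ∑ y, |p y - 1 / 2 ^ T| ≤ ∑ y, (p y + 1 / 2 ^ T) := by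
    refine sum_le_sum fun y _ => abs_le.2 ⟨?_, ?_⟩
    · linarith [h0 y]
    · have : (0 : ℝ) ≤ 1 / 2 ^ T := by positivity
      linarith
  rw [sum_add_distrib, hp, sum_const, nsmul_eq_mul, hcard, mul_one_div_cancel (by positivity)]
    at this
  rw [tvFromUniform]
  linarith

variable {V E : Type*} [Fintype V] [DecidableEq V] [Fintype E] [DecidableEq E] {n T : ℕ}

theorem hardProb_nonneg [Nonempty E] {D : Layout E n T} {ε : ℝ} (hε : 0 ≤ ε) (hε1 : ε ≤ 1)
    (ω : Instance V D) : 0 ≤ hardProb ε ω := by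
  have h0 : 0 ≤ ε ^ (1 / (Fintype.card E : ℝ)) := Real.rpow_nonneg hε _
  have h1 : ε ^ (1 / (Fintype.card E : ℝ)) ≤ 1 := Real.rpow_le_one hε hε1 (by positivity)
  unfold hardProb
  have : 0 ≤ ∏ e : E, ∏ i : Fin n,
      if ω.xt e i = ω.x e i then 1 - (1 / 2 - ε ^ (1 / (Fintype.card E : ℝ)) / 2)
      else 1 / 2 - ε ^ (1 / (Fintype.card E : ℝ)) / 2 :=
    prod_nonneg fun e _ => prod_nonneg fun i _ => by split_ifs <;> linarith
  positivity

theorem sum_hardProb {D : Layout E n T} (ε : ℝ) : ∑ ω : Instance V D, hardProb ε ω = 1 := by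
  have h := expect_prod_xt (V := V) (D := D) ε (fun _ _ _ => 1)
  simp only [expect, prod_const_one, mul_one, sum_const, card_univ, nsmul_eq_mul] at h
  have h1 : ∀ _e : E, ((2 : ℝ) ^ n)⁻¹ * (Fintype.card (Fin n → ZMod 2) : ℕ) = 1 := fun _ => by
    simp [ZMod.card]
  rw [h, prod_congr rfl fun e _ => h1 e, prod_const_one, mul_one, inv_mul_cancel₀ (by positivity)]

theorem posterior_nonneg [Nonempty E] {H : MultiHypergraph V E} {D : Layout E n T} {ε : ℝ}
    (hε : 0 ≤ ε) (hε1 : ε ≤ 1) (P : Protocol H D) (ω : Instance V D) (y : Fin T → ZMod 2) :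
    0 ≤ posterior ε P ω y := by
  refine div_nonneg ?_ (prob_sameView_pos ε P ω).le
  exact sum_nonneg fun ω' _ => mul_nonneg (hardProb_nonneg hε hε1 ω') (by dsimp only; split_ifs <;> norm_num)

theorem expect_mono [Nonempty E] {D : Layout E n T} {ε : ℝ} (hε : 0 ≤ ε) (hε1 : ε ≤ 1)
    {X Y : Instance V D → ℝ} (h : ∀ ω, X ω ≤ Y ω) : expect ε X ≤ expect ε Y :=
  sum_le_sum fun ω _ => mul_le_mul_of_nonneg_left (h ω) (hardProb_nonneg hε hε1 ω)

theorem expect_const {D : Layout E n T} (ε a : ℝ) : expect ε (fun _ : Instance V D => a) = a := by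
  rw [expect, ← sum_mul, sum_hardProb, one_mul]

theorem expect_sq_le [Nonempty E] {D : Layout E n T} {ε : ℝ} (hε : 0 ≤ ε) (hε1 : ε ≤ 1)
    (X : Instance V D → ℝ) (hX : ∀ ω, 0 ≤ X ω) : expect ε X ^ 2 ≤ expect ε fun ω => X ω ^ 2 :=
  Real.pow_arith_mean_le_arith_mean_pow univ _ _ (fun ω _ => hardProb_nonneg hε hε1 ω)
    (sum_hardProb ε) (fun ω _ => hX ω) 2

theorem expect_posterior_fourier_sq [Nonempty E] {H : MultiHypergraph V E} {D : Layout E n T}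
    {ε : ℝ} (hε : 0 ≤ ε) (P : Protocol H D) (s : Finset (Fin T)) :
    expect ε (fun ω => (∑ y, walsh s y * posterior ε P ω y) ^ 2) = ε ^ (2 * #s) *
      ((∑ θ : Perms V D, ∏ e, condEnergy (msgFun P e θ) (s.map (Fin.castLEEmb D.T_le))) /
        Fintype.card (Perms V D)) := by
  simp only [posterior_fourier hε, mul_pow, ← prod_pow, ← pow_mul, mul_comm #s]
  have h := expect_prod_xt (V := V) (D := D) ε
    (fun e θ x => condWalsh (msgFun P e θ) (s.map (Fin.castLEEmb D.T_le)) x ^ 2)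
  have e1 : ∀ X : Instance V D → ℝ,
      expect ε (fun ω => ε ^ (2 * #s) * X ω) = ε ^ (2 * #s) * expect ε X := by
    intro X
    simp only [expect, mul_sum]
    exact sum_congr rfl fun ω _ => by ring
  rw [e1, h, div_eq_inv_mul]
  congr 2
  refine sum_congr rfl fun θ _ => prod_congr rfl fun e _ => ?_
  rw [condEnergy, div_eq_inv_mul]
  simp [ZMod.card]

/-- The expected total variation distance in terms of bounds on the energies of each level. -/
theorem four_mul_expect_tv_sq_le [Nonempty E] {H : MultiHypergraph V E} {D : Layout E n T}
    {ε : ℝ} (hε : 0 ≤ ε) (hε1 : ε ≤ 1) (P : Protocol H D) (A : ℕ → ℝ)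
    (hA : ∀ (e : E) (s : Finset (Fin n)), 1 ≤ #s → #s ≤ T → avgEnergy P e s ≤ A #s) :
    4 * expect ε (fun ω => tvFromUniform (posterior ε P ω)) ^ 2
      ≤ ∑ k ∈ Icc 1 T, T.choose k * (ε ^ (2 * k) * A k ^ H.MVC 1) := by
  have htv : ∀ ω, 0 ≤ tvFromUniform (posterior ε P ω) := fun ω => by
    unfold tvFromUniform; positivity
  have h1 : 4 * expect ε (fun ω => tvFromUniform (posterior ε P ω)) ^ 2
      ≤ expect ε (fun ω => ∑ s ∈ univ.erase ∅, (∑ y, walsh s y * posterior ε P ω y) ^ 2) := by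
    refine (mul_le_mul_of_nonneg_left (expect_sq_le hε hε1 _ htv) (by norm_num)).trans ?_
    refine le_trans ?_ (expect_mono hε hε1 fun ω =>
      four_mul_tvFromUniform_sq_le _ (sum_posterior ε P ω))
    rw [expect, expect, mul_sum]
    exact (sum_congr rfl fun ω _ => by ring).le
  have h2 : expect ε (fun ω => ∑ s ∈ univ.erase ∅, (∑ y, walsh s y * posterior ε P ω y) ^ 2)
      = ∑ s ∈ univ.erase ∅, expect ε (fun ω => (∑ y, walsh s y * posterior ε P ω y) ^ 2) := by
    simp only [expect, mul_sum]
    exact sum_comm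
  rw [h2] at h1
  refine h1.trans ?_
  set B : ℕ → ℝ := fun k => if k = 0 then 0 else ε ^ (2 * k) * A k ^ H.MVC 1 with hB
  have h3 : ∀ s ∈ (univ : Finset (Finset (Fin T))).erase ∅,
      expect ε (fun ω => (∑ y, walsh s y * posterior ε P ω y) ^ 2) ≤ B #s := by
    intro s hs
    have hs0 : #s ≠ 0 := card_ne_zero.2 (nonempty_iff_ne_empty.2 (mem_erase.1 hs).1)
    have hsT : #s ≤ T := by simpa using card_le_univ s
    rw [expect_posterior_fourier_sq hε, hB]
    simp only [if_neg hs0]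
    refine mul_le_mul_of_nonneg_left (avg_prod_condEnergy_le P _ _ fun e => ?_) (by positivity)
    have := hA e (s.map (Fin.castLEEmb D.T_le))
    rw [card_map] at this
    exact this (Nat.one_le_iff_ne_zero.2 hs0) hsT
  refine (sum_le_sum h3).trans ?_
  have h4 : ∑ s ∈ (univ : Finset (Finset (Fin T))).erase ∅, B #s
      = ∑ s ∈ (univ : Finset (Fin T)).powerset, B #s := by
    rw [powerset_univ]
    refine sum_erase _ ?_
    simp [hB]
  rw [h4, sum_powerset_apply_card, card_univ, Fintype.card_fin, range_eq_Ico,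
    sum_eq_sum_Ico_succ_bot (Nat.succ_pos T)]
  simp only [hB, if_true, smul_zero, zero_add, nsmul_eq_mul]
  refine (sum_congr rfl fun k hk => ?_).le
  rw [if_neg (by have := (mem_Icc.1 hk).1; omega)]

end CountingGame

theorem choose_mul_pow_le {T n : ℕ} (h : T ≤ n) (k : ℕ) :
    T.choose k * n ^ k ≤ T ^ k * n.choose k := by
  have key : T.descFactorial k * n ^ k ≤ T ^ k * n.descFactorial k := by
    induction k with
    | zero => simp
    | succ k ih =>
      rw [Nat.descFactorial_succ, Nat.descFactorial_succ]
      have hstep : (T - k) * n ≤ T * (n - k) := by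
        rw [Nat.sub_mul, Nat.mul_sub]
        exact Nat.sub_le_sub_left (by rw [mul_comm T]; exact Nat.mul_le_mul_left k h) _
      calc (T - k) * T.descFactorial k * n ^ (k + 1)
          = ((T - k) * n) * (T.descFactorial k * n ^ k) := by ring
        _ ≤ (T * (n - k)) * (T ^ k * n.descFactorial k) := Nat.mul_le_mul hstep ih
        _ = _ := by ring
  rw [Nat.descFactorial_eq_factorial_mul_choose, Nat.descFactorial_eq_factorial_mul_choose] at key
  refine Nat.le_of_mul_le_mul_left ?_ (Nat.factorial_pos k)
  calc k.factorial * (T.choose k * n ^ k) = k.factorial * T.choose k * n ^ k := by ring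
    _ ≤ _ := key
    _ = _ := by ring

theorem choose_div_choose_le {T n k : ℕ} (h : T ≤ n) (hk : k ≤ n) (hn : 0 < n) :
    (T.choose k : ℝ) / n.choose k ≤ (T / n) ^ k := by
  have hpos : (0 : ℝ) < n.choose k := by exact_mod_cast Nat.choose_pos hk
  have hn' : (0 : ℝ) < n := by exact_mod_cast hn
  rw [div_pow, div_le_div_iff₀ hpos (by positivity)]
  exact_mod_cast choose_mul_pow_le h k

theorem inv_choose_le {n k : ℕ} (hk : k ≤ n) (hn : 0 < n) :
    1 / (n.choose k : ℝ) ≤ (k / n) ^ k := by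
  simpa using choose_div_choose_le hk hk hn

theorem mul_rpow_le_of_le_div_rpow {n T c : ℕ} {ε δ μ : ℝ} (hn : 0 < n) (hT : 1 ≤ T) (hc1 : 1 ≤ c)
    (hμ : 1 ≤ μ) (hε : 0 < ε) (hδ : 0 < δ)
    (hc : (c : ℝ) ≤ 1 / 20 * (n / (ε ^ 2 * T / δ ^ 2) ^ (1 / μ))) :
    ε ^ 2 * T * (20 * c / n) ^ μ ≤ δ ^ 2 := by
  have hn' : (0 : ℝ) < n := by exact_mod_cast hn
  have hc' : (0 : ℝ) < c := by exact_mod_cast hc1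
  have hT' : (0 : ℝ) < T := by exact_mod_cast hT
  have hμ0 : 0 < μ := by linarith
  set X := ε ^ 2 * T / δ ^ 2 with hX
  have hX0 : 0 < X := by positivity
  have hY0 : 0 < X ^ (1 / μ) := Real.rpow_pos_of_pos hX0 _
  have h1 : X ^ (1 / μ) * (20 * c / n) ≤ 1 := by
    have : 20 * c * X ^ (1 / μ) ≤ n := by
      have := mul_le_mul_of_nonneg_right hc hY0.le
      rw [mul_assoc, div_mul_cancel₀ _ hY0.ne'] at this
      linarith
    rw [← mul_div_assoc, div_le_one hn']
    linarith
  have h2 := Real.rpow_le_rpow (by positivity) h1 hμ0.le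
  rw [Real.one_rpow, Real.mul_rpow hY0.le (by positivity), ← Real.rpow_mul hX0.le,
    one_div_mul_cancel hμ0.ne', Real.rpow_one, hX, div_mul_eq_mul_div,
    div_le_one (by positivity)] at h2
  exact h2

/-- For every level some exponent in the level inequality gives a geometrically small
contribution. -/
theorem exists_level_bound {n T c k : ℕ} {ε δ μ : ℝ} (hk1 : 1 ≤ k) (hkT : k ≤ T)
    (hTn : (T : ℝ) < n / 10) (hc1 : 1 ≤ c) (hμ : 1 ≤ μ) (hε : 0 < ε) (hε1 : ε < 1) (hδ : 0 < δ)
    (hδ1 : δ ≤ 1) (hc : (c : ℝ) ≤ 1 / 20 * (n / (ε ^ 2 * T / δ ^ 2) ^ (1 / μ))) :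
    ∃ m : ℕ, 1 ≤ m ∧ c + 1 ≤ k * m ∧
      T.choose k * (ε ^ (2 * k) * ((2 * (2 * m - 1)) ^ k / n.choose k : ℝ) ^ μ)
        ≤ δ ^ 2 * (1 / 2) ^ k := by
  have hT1 : 1 ≤ T := hk1.trans hkT
  have hT' : (0 : ℝ) < T := by exact_mod_cast hT1
  have hn' : (0 : ℝ) < n := by linarith
  have hn : 0 < n := by exact_mod_cast hn'
  have hTn' : T ≤ n := by
    have : (T : ℝ) ≤ n := by linarith
    exact_mod_cast this
  have hkn : k ≤ n := hkT.trans hTn'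
  have hk' : (0 : ℝ) < k := by exact_mod_cast hk1
  have hc' : (1 : ℝ) ≤ c := by exact_mod_cast hc1
  have hμ0 : 0 < μ := by linarith
  have hCpos : (0 : ℝ) < n.choose k := by exact_mod_cast Nat.choose_pos hkn
  have hkey := mul_rpow_le_of_le_div_rpow hn hT1 hc1 hμ hε hδ hc
  have hinv := inv_choose_le hkn hn
  rcases le_or_gt k c with hkc | hkc
  · refine ⟨c / k + 1, Nat.succ_pos _, Nat.lt_mul_div_succ c hk1, ?_⟩
    have hm : (2 * (2 * ((c / k + 1 : ℕ) : ℝ) - 1)) ≤ 6 * c / k := by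
      have h1 : ((c / k : ℕ) : ℝ) ≤ c / k := Nat.cast_div_le
      have h2 : (1 : ℝ) ≤ c / k := by
        rw [le_div_iff₀ hk', one_mul]; exact_mod_cast hkc
      push_cast
      rw [mul_div_assoc]
      linarith
    have hm0 : 0 ≤ (2 * (2 * ((c / k + 1 : ℕ) : ℝ) - 1)) := by
      push_cast
      have : (0 : ℝ) ≤ ((c / k : ℕ) : ℝ) := by positivity
      linarith
    have hA : (2 * (2 * ((c / k + 1 : ℕ) : ℝ) - 1)) ^ k / n.choose k ≤ (6 * c / n) ^ k := by
      calc (2 * (2 * ((c / k + 1 : ℕ) : ℝ) - 1)) ^ k / n.choose k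
          = (2 * (2 * ((c / k + 1 : ℕ) : ℝ) - 1)) ^ k * (1 / n.choose k) := by ring
        _ ≤ (6 * c / k) ^ k * (k / n) ^ k := by gcongr
        _ = (6 * c / n) ^ k := by
          rw [← mul_pow]
          congr 1
          field_simp
    have hpow : ((2 * (2 * ((c / k + 1 : ℕ) : ℝ) - 1)) ^ k / n.choose k) ^ μ
        ≤ (1 / 2 * (20 * c / n) ^ μ) ^ k := by
      calc ((2 * (2 * ((c / k + 1 : ℕ) : ℝ) - 1)) ^ k / n.choose k) ^ μ
          ≤ ((6 * c / n) ^ k) ^ μ :=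
            Real.rpow_le_rpow (div_nonneg (pow_nonneg hm0 _) hCpos.le) hA hμ0.le
        _ = ((6 * c / n) ^ μ) ^ k := by
          have hb : (0 : ℝ) ≤ 6 * c / n := by positivity
          rw [← Real.rpow_natCast, ← Real.rpow_mul hb, mul_comm (k : ℝ), Real.rpow_mul hb,
            Real.rpow_natCast]
        _ = ((3 / 10) ^ μ * (20 * c / n) ^ μ) ^ k := by
          rw [← Real.mul_rpow (by norm_num) (by positivity)]
          congr 2
          ring
        _ ≤ _ := by
          gcongr
          calc (3 / 10 : ℝ) ^ μ ≤ (3 / 10) ^ (1 : ℝ) :=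
                Real.rpow_le_rpow_of_exponent_ge (by norm_num) (by norm_num) hμ
            _ ≤ 1 / 2 := by norm_num
    have hch : (T.choose k : ℝ) ≤ T ^ k := by exact_mod_cast Nat.choose_le_pow T k
    calc (T.choose k : ℝ) *
          (ε ^ (2 * k) * ((2 * (2 * ((c / k + 1 : ℕ) : ℝ) - 1)) ^ k / n.choose k) ^ μ)
        ≤ T ^ k * (ε ^ (2 * k) * (1 / 2 * (20 * c / n) ^ μ) ^ k) := by gcongr
      _ = (1 / 2) ^ k * (ε ^ 2 * T * (20 * c / n) ^ μ) ^ k := by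
          rw [pow_mul, ← mul_pow, ← mul_pow, ← mul_pow]
          congr 1
          ring
      _ ≤ (1 / 2) ^ k * (δ ^ 2) ^ k := by gcongr
      _ ≤ (1 / 2) ^ k * δ ^ 2 := by
          gcongr
          exact pow_le_of_le_one (by positivity) (pow_le_one₀ hδ.le hδ1) (by omega)
      _ = _ := by ring
  · refine ⟨1, le_rfl, by omega, ?_⟩
    norm_num only
    obtain ⟨j, rfl⟩ : ∃ j, k = j + 1 := ⟨k - 1, by omega⟩
    set C : ℝ := ((n.choose (j + 1) : ℕ) : ℝ) with hC
    have hkn10 : (j + 1 : ℝ) / n ≤ 1 / 10 := by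
      have : ((j + 1 : ℕ) : ℝ) ≤ T := by exact_mod_cast hkT
      push_cast at this
      rw [div_le_iff₀ hn']
      linarith
    have hj5 : (j + 1 : ℝ) * (1 / 5) ^ j ≤ 1 := by
      have : j + 1 ≤ 5 ^ j := Nat.lt_pow_self (by norm_num)
      have : (j + 1 : ℝ) ≤ 5 ^ j := by exact_mod_cast this
      rw [one_div, inv_pow, ← div_eq_mul_inv, div_le_one (by positivity)]
      exact this
    have hA : 2 ^ (j + 1) / C ≤ 2 / n := by
      calc 2 ^ (j + 1) / C = 2 ^ (j + 1) * (1 / C) := by ring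
        _ ≤ 2 ^ (j + 1) * (((j + 1 : ℕ) : ℝ) / n) ^ (j + 1) := by gcongr
        _ = 2 * (j + 1) / n * (2 * ((j + 1) / n)) ^ j := by
            push_cast
            rw [← mul_pow, pow_succ]; ring
        _ ≤ 2 * (j + 1) / n * (2 * (1 / 10)) ^ j := by gcongr
        _ = 2 / n * ((j + 1) * (1 / 5) ^ j) := by norm_num; ring
        _ ≤ 2 / n * 1 := by gcongr
        _ = 2 / n := mul_one _
    have hA0 : 0 < 2 ^ (j + 1) / C := by positivity
    have hTA : T.choose (j + 1) * (2 ^ (j + 1) / C) ≤ 2 * T / n * (1 / 5) ^ j := by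
      calc T.choose (j + 1) * (2 ^ (j + 1) / C) = 2 ^ (j + 1) * (T.choose (j + 1) / C) := by ring
        _ ≤ 2 ^ (j + 1) * (T / n) ^ (j + 1) := by
            gcongr
            exact choose_div_choose_le hTn' hkn hn
        _ = 2 * T / n * (2 * (T / n)) ^ j := by
            rw [← mul_pow, pow_succ]; ring
        _ ≤ 2 * T / n * (2 * (1 / 10)) ^ j := by
            have hTn10 : (T : ℝ) / n ≤ 1 / 10 := by
              rw [div_le_iff₀ hn']
              linarith
            gcongr 2 * T / n * (2 * ?_) ^ j
        _ = _ := by norm_num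
    have hsplit : (2 ^ (j + 1) / C) ^ μ ≤ 2 ^ (j + 1) / C * (2 / n) ^ (μ - 1) := by
      calc (2 ^ (j + 1) / C) ^ μ = (2 ^ (j + 1) / C) ^ (1 : ℝ) * (2 ^ (j + 1) / C) ^ (μ - 1) := by
            rw [← Real.rpow_add hA0]; congr 1; ring
        _ ≤ _ := by
            rw [Real.rpow_one]
            gcongr
    have hε2 : ε ^ (2 * (j + 1)) ≤ ε ^ 2 :=
      pow_le_pow_of_le_one hε.le hε1.le (by omega)
    have hmu : (2 / n : ℝ) * (2 / n) ^ (μ - 1) ≤ 1 / 10 * (20 * c / n) ^ μ := by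
      calc (2 / n : ℝ) * (2 / n) ^ (μ - 1) = (2 / n) ^ μ := by
            nth_rewrite 1 [← Real.rpow_one (2 / n : ℝ)]
            rw [← Real.rpow_add (by positivity)]
            congr 1; ring
        _ = (1 / 10) ^ μ * (20 / n) ^ μ := by
            rw [← Real.mul_rpow (by norm_num) (by positivity)]
            congr 1; ring
        _ ≤ (1 / 10) ^ (1 : ℝ) * (20 * c / n) ^ μ := by
            gcongr ?_ * ?_
            · exact Real.rpow_le_rpow_of_exponent_ge (by norm_num) (by norm_num) hμ
            · gcongr
              linarith
        _ = _ := by rw [Real.rpow_one]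
    calc (T.choose (j + 1) : ℝ) * (ε ^ (2 * (j + 1)) * (2 ^ (j + 1) / C) ^ μ)
        ≤ T.choose (j + 1) * (ε ^ 2 * (2 ^ (j + 1) / C * (2 / n) ^ (μ - 1))) := by gcongr
      _ = ε ^ 2 * (2 / n) ^ (μ - 1) * (T.choose (j + 1) * (2 ^ (j + 1) / C)) := by ring
      _ ≤ ε ^ 2 * (2 / n) ^ (μ - 1) * (2 * T / n * (1 / 5) ^ j) := by gcongr
      _ = ε ^ 2 * T * (2 / n * (2 / n) ^ (μ - 1)) * (1 / 5) ^ j := by ring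
      _ ≤ ε ^ 2 * T * (1 / 10 * (20 * c / n) ^ μ) * (1 / 2) ^ j := by
          gcongr
          norm_num
      _ = ε ^ 2 * T * (20 * c / n) ^ μ * (1 / 10 * (1 / 2) ^ j) := by ring
      _ ≤ δ ^ 2 * (1 / 2 * (1 / 2) ^ j) := by gcongr; norm_num
      _ = _ := by ring

namespace CountingGame

variable {V E : Type*} [Fintype V] [DecidableEq V] [Fintype E] [DecidableEq E] {n T : ℕ}

/-- With few bits of communication the posterior is close to uniform on average. -/
theorem expect_tv_posterior_le [Nonempty E] (H : MultiHypergraph V E) {c : ℕ} {ε δ : ℝ}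
    (D : Layout E n T) (hTn : (T : ℝ) < n / 10) (hc1 : 1 ≤ c) (hε : 0 < ε) (hε1 : ε < 1)
    (hδ : 0 < δ) (hc : (c : ℝ) ≤ 1 / 20 * (n / (ε ^ 2 * T / δ ^ 2) ^ (1 / H.MVC 1)))
    (P : Protocol H D) (hP : P.AtMostBits c) :
    expect ε (fun ω => tvFromUniform (posterior ε P ω)) ≤ δ := by
  rcases le_or_gt 1 δ with hδ1 | hδ1
  · refine (expect_mono hε.le hε1.le (Y := fun _ => δ) fun ω => ?_).trans_eq (expect_const ε δ)
    exact (tvFromUniform_le_one _ (sum_posterior ε P ω)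
      (posterior_nonneg hε.le hε1.le P ω)).trans hδ1
  have hlev : ∀ k, 1 ≤ k → k ≤ T → _ := fun k hk1 hkT =>
    exists_level_bound hk1 hkT hTn hc1 H.one_le_MVC_one hε hε1 hδ hδ1.le hc
  choose! m hm1 hmk hm using hlev
  have h := four_mul_expect_tv_sq_le hε.le hε1.le P
    (fun k => (2 * (2 * (m k : ℝ) - 1)) ^ k / n.choose k)
    (fun e s hs1 hsT => avgEnergy_le hP e s (m #s) (hm1 _ hs1 hsT) (hmk _ hs1 hsT))
  have h2 : ∑ k ∈ Icc 1 T, (T.choose k * (ε ^ (2 * k) *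
      ((2 * (2 * (m k : ℝ) - 1)) ^ k / n.choose k) ^ H.MVC 1)) ≤ 2 * δ ^ 2 := by
    calc _ ≤ ∑ k ∈ Icc 1 T, δ ^ 2 * (1 / 2) ^ k :=
          sum_le_sum fun k hk => hm k (mem_Icc.1 hk).1 (mem_Icc.1 hk).2
      _ ≤ ∑ k ∈ range (T + 1), δ ^ 2 * (1 / 2) ^ k :=
          sum_le_sum_of_subset_of_nonneg
            (fun k hk => mem_range.2 (Nat.lt_succ_of_le (mem_Icc.1 hk).2))
            fun _ _ _ => by positivity
      _ ≤ 2 * δ ^ 2 := by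
          rw [← mul_sum, mul_comm]
          exact mul_le_mul_of_nonneg_right (sum_geometric_two_le _) (by positivity)
  refine le_of_sq_le_sq ?_ hδ.le
  have : 0 ≤ δ ^ 2 := by positivity
  linarith

omit [Fintype V] [DecidableEq V] [DecidableEq E] in
theorem SameView.eq_iff {H : MultiHypergraph V E} {D : Layout E n T} {P : Protocol H D}
    {ω ω' : Instance V D} (h : SameView P ω ω') (ω'' : Instance V D) :
    SameView P ω ω'' ↔ SameView P ω' ω'' := by
  unfold SameView at h ⊢
  rw [h.1, h.2.1, h.2.2]

omit [Fintype V] [DecidableEq V] [DecidableEq E] in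
theorem SameView.symm {H : MultiHypergraph V E} {D : Layout E n T} {P : Protocol H D}
    {ω ω' : Instance V D} (h : SameView P ω ω') : SameView P ω' ω :=
  ⟨h.1.symm, h.2.1.symm, h.2.2.symm⟩

open Classical in
/-- The tower property: expectations may be taken conditionally on the referee's view. -/
theorem expect_eq_expect_cond {H : MultiHypergraph V E} {D : Layout E n T} (ε : ℝ)
    (P : Protocol H D) (F : Instance V D → ℝ) :
    expect ε F = expect ε (fun ω => expect ε (fun ω' => if SameView P ω ω' then F ω' else 0) /
      prob ε (fun ω' => SameView P ω ω')) := by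
  have h1 : ∀ ω', ∑ ω, hardProb ε ω * (if SameView P ω ω' then
      (prob ε (fun ω'' => SameView P ω ω''))⁻¹ else 0) = 1 := by
    intro ω'
    have : ∀ ω, hardProb ε ω * (if SameView P ω ω' then
        (prob ε (fun ω'' => SameView P ω ω''))⁻¹ else 0)
        = hardProb ε ω * (if SameView P ω' ω then 1 else 0) *
          (prob ε (fun ω'' => SameView P ω' ω''))⁻¹ := by
      intro ω
      by_cases h : SameView P ω ω'
      · have e : (fun ω'' => SameView P ω ω'') = fun ω'' => SameView P ω' ω'' :=
          funext fun ω'' => propext (h.eq_iff ω'')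
        rw [if_pos h, if_pos h.symm, e, mul_one]
      · rw [if_neg h, if_neg fun h' => h h'.symm]
        ring
    rw [sum_congr rfl fun ω _ => this ω, ← sum_mul]
    exact mul_inv_cancel₀ (prob_sameView_pos ε P ω').ne'
  calc expect ε F = ∑ ω', hardProb ε ω' * F ω' * ∑ ω, hardProb ε ω * (if SameView P ω ω' then
      (prob ε (fun ω'' => SameView P ω ω''))⁻¹ else 0) := by
        simp only [h1, mul_one]; rfl
    _ = ∑ ω, ∑ ω', hardProb ε ω' * F ω' * (hardProb ε ω * (if SameView P ω ω' then
      (prob ε (fun ω'' => SameView P ω ω''))⁻¹ else 0)) := by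
        simp only [mul_sum]
        exact sum_comm
    _ = _ := by
        refine sum_congr rfl fun ω _ => ?_
        dsimp only
        rw [div_eq_mul_inv, expect, sum_mul, mul_sum]
        refine sum_congr rfl fun ω' _ => ?_
        split_ifs <;> ring

open Classical in
/-- Given the referee's view, the bit `τ` is uniform and independent of the strings. -/
theorem expect_sameView_tau {H : MultiHypergraph V E} {D : Layout E n T} (ε : ℝ)
    (P : Protocol H D) (ω : Instance V D) (f : ZMod 2 → (Fin T → ZMod 2) → ℝ) :
    expect ε (fun ω' => if SameView P ω ω' then f ω'.tau (xorPrefix ω') else 0)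
      = expect ε (fun ω' => if SameView P ω ω' then 1 / 2 * ∑ b, f b (xorPrefix ω') else 0) := by
  rw [expect_eq, expect_eq]
  congr 1
  refine sum_congr rfl fun θ _ => ?_
  have hS : ∀ z b, SameView P ω (mkInstance z θ b) ↔ SameView P ω (mkInstance z θ 0) :=
    fun z b => Iff.rfl
  have hX : ∀ z b, xorPrefix (mkInstance (V := V) z θ b) = xorPrefix (mkInstance z θ 0) :=
    fun z b => rfl
  have ht : ∀ z b, (mkInstance (V := V) z θ b).tau = b := fun z b => rfl
  simp only [hS _ _, hX _ _, ht]
  simp only [← mul_sum]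
  congr 1
  rw [sum_comm, sum_const, card_univ, ZMod.card, smul_sum]
  refine sum_congr rfl fun z _ => ?_
  rw [← mul_sum]
  split_ifs
  · rw [nsmul_eq_mul]; push_cast; ring
  · simp

/-- Distinguishing two complementary shifts of a random string is no easier than its total
variation distance from uniform allows. -/
theorem sum_guess_mul_le (p : (Fin T → ZMod 2) → ℝ) (hp : ∑ y, p y = 1)
    (g : (Fin T → ZMod 2) → ZMod 2) :
    ∑ y, (1 / 2 * ∑ b : ZMod 2, if g (fun j => b + y j) = b then (1 : ℝ) else 0) * p y
      ≤ 1 / 2 + tvFromUniform p := by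
  set N : (Fin T → ZMod 2) → ℝ := fun y =>
    ∑ b : ZMod 2, if g (fun j => b + y j) = b then (1 : ℝ) else 0 with hN
  have hcard : (#(univ : Finset (Fin T → ZMod 2)) : ℝ) = 2 ^ T := by
    simp [card_univ, ZMod.card]
  have hu : ∑ _y : Fin T → ZMod 2, (1 : ℝ) / 2 ^ T = 1 := by
    rw [sum_const, nsmul_eq_mul, hcard, mul_one_div_cancel (by positivity)]
  have hNsum : ∑ y, N y = 2 ^ T := by
    rw [hN, sum_comm]
    have : ∀ b : ZMod 2, ∑ y : Fin T → ZMod 2, (if g (fun j => b + y j) = b then (1 : ℝ) else 0)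
        = ∑ y, if g y = b then (1 : ℝ) else 0 := fun b =>
      Equiv.sum_comp (Equiv.addLeft (fun _ : Fin T => b)) fun y => if g y = b then (1 : ℝ) else 0
    simp only [this]
    rw [sum_comm]
    simp only [sum_ite_eq, mem_univ, if_true, sum_const, nsmul_eq_mul, hcard, mul_one]
  have hN0 : ∀ y, 0 ≤ N y := fun y => sum_nonneg fun b _ => by split_ifs <;> norm_num
  have hN2 : ∀ y, N y ≤ 2 := by
    intro y
    calc N y ≤ ∑ _b : ZMod 2, (1 : ℝ) := sum_le_sum fun b _ => by split_ifs <;> norm_num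
      _ = 2 := by simp [ZMod.card]
  have hpt : ∀ y, N y * p y ≤ N y * (1 / 2 ^ T) + (p y - 1 / 2 ^ T) + |p y - 1 / 2 ^ T| := by
    intro y
    have h1 : (N y - 1) * (p y - 1 / 2 ^ T) ≤ |p y - 1 / 2 ^ T| := by
      refine (le_abs_self _).trans ?_
      rw [abs_mul]
      refine mul_le_of_le_one_left (abs_nonneg _) (abs_le.2 ⟨?_, ?_⟩)
      · linarith [hN0 y]
      · linarith [hN2 y]
    linarith
  have hs := sum_le_sum fun y (_ : y ∈ (univ : Finset (Fin T → ZMod 2))) => hpt y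
  rw [sum_add_distrib, sum_add_distrib, sum_sub_distrib, hp, hu, ← sum_mul, hNsum,
    mul_one_div_cancel (by positivity)] at hs
  rw [tvFromUniform]
  simp only [mul_assoc, ← mul_sum]
  linarith

theorem successProb_le [Nonempty E] {H : MultiHypergraph V E} {D : Layout E n T} {ε : ℝ}
    (hε : 0 ≤ ε) (hε1 : ε ≤ 1) (P : Protocol H D) (G : Referee V D) :
    successProb ε P G ≤ 1 / 2 + expect ε (fun ω => tvFromUniform (posterior ε P ω)) := by
  classical
  have h2 : expect ε (fun ω : Instance V D => 1 / 2 + tvFromUniform (posterior ε P ω))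
      = 1 / 2 + expect ε (fun ω => tvFromUniform (posterior ε P ω)) := by
    simp only [expect, mul_add, sum_add_distrib]
    rw [← sum_mul, sum_hardProb, one_mul]
  rw [← h2, successProb, prob, expect_eq_expect_cond ε P]
  refine expect_mono hε hε1 fun ω => ?_
  refine le_trans (le_of_eq ?_) (sum_guess_mul_le _ (sum_posterior ε P ω)
    fun y => G (messages P ω) ω.permE ω.permV y)
  rw [sum_mul_posterior, ← expect_sameView_tau ε P ω
    fun b y => if G (messages P ω) ω.permE ω.permV (fun j => b + y j) = b then 1 else 0]
  congr 2
  funext ω'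
  by_cases h : SameView P ω ω'
  · rw [if_pos h, if_pos h, h.1, h.2.1, h.2.2]
    congr
  · rw [if_neg h, if_neg h]

end CountingGame

theorem theorem6p1 {V E : Type*} [Fintype V] [DecidableEq V] [Fintype E] [DecidableEq E]
    (H : MultiHypergraph V E) (hconn : H.Connected) (hE : 1 < Fintype.card E) :
    ∃ γ : ℝ, 0 < γ ∧
      ∀ (n T c : ℕ) (ε δ : ℝ) (D : CountingGame.Layout E n T),
        1 ≤ T → (T : ℝ) < n / 10 → 1 ≤ c → c ≤ n → 0 < ε → ε < 1 → 0 < δ →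
        (c : ℝ) ≤ γ * (n / (ε ^ 2 * T / δ ^ 2) ^ (1 / H.MVC 1)) →
        (∀ P : CountingGame.Protocol H D, P.AtMostBits c →
          CountingGame.expect ε
            (fun ω => CountingGame.tvFromUniform (CountingGame.posterior ε P ω)) ≤ δ) ∧
        (∀ (R : Type) [Fintype R] (q : R → ℝ) (P : R → CountingGame.Protocol H D)
          (G : R → CountingGame.Referee V D),
          (∀ r, 0 ≤ q r) → ∑ r, q r = 1 → (∀ r, (P r).AtMostBits c) →
          ∑ r, q r * CountingGame.successProb ε (P r) (G r) ≤ 1 / 2 + δ) := by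
  have : Nonempty E := Fintype.card_pos_iff.1 (by omega)
  refine ⟨1 / 20, by norm_num, fun n T c ε δ D hT hTn hc1 hcn hε hε1 hδ hc => ?_⟩
  have part1 : ∀ P : CountingGame.Protocol H D, P.AtMostBits c →
      CountingGame.expect ε
        (fun ω => CountingGame.tvFromUniform (CountingGame.posterior ε P ω)) ≤ δ :=
    CountingGame.expect_tv_posterior_le H D hTn hc1 hε hε1 hδ hc
  refine ⟨part1, fun R _ q P G hq hq1 hP => ?_⟩
  calc ∑ r, q r * CountingGame.successProb ε (P r) (G r)
      ≤ ∑ r, q r * (1 / 2 + δ) := by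
        refine sum_le_sum fun r _ => mul_le_mul_of_nonneg_left ?_ (hq r)
        have h1 := CountingGame.successProb_le hε.le hε1.le (P r) (G r)
        have h2 := part1 (P r) (hP r)
        linarith
    _ = 1 / 2 + δ := by rw [← sum_mul, hq1, one_mul]
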